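/- Let $\mathbb{F}$ be a finite field with $q$ elements, $C$ a smooth projective geometrically irreducible curve over $\mathbb{F}$, $\infty$ a closed point of $C$, $A=H^0(C\setminus\{\infty\},\mathcal{O}_C)$, and $K$ the function field of $C$. Let $\mathbb{C}_\infty$ be the completion of an algebraic closure of $K$ at a place above $\infty$, and let $L$ be a field with $K\subseteq L\subseteq\mathbb{C}_\infty$; write $\ell:A\to L$ for the inclusion. Unlabelled tensor products are over $\mathbb{F}$. Let $E$ be a Drinfeld–Hayes module over $L$: an $\mathbb{F}$-vector space scheme over $L$ isomorphic to $\mathbb{G}_{a,L}$, with a homomorphism of $\mathbb{F}$-algebras $\phi:A\to\operatorname{End}_{\mathbb{F},L}(E)$, $a\mapsto\phi_a$, such that $\partial\phi_a-\ell(a)$ is nilpotent on $\operatorname{Lie}_E(L)$ for all $a\in A$, and such that the motive $\mathsf{M}=\operatorname{Hom}_{\mathbb{F},L}(E,\mathbb{G}_{a,L})$ is a finitely generated $A\otimes L$-module of rank one (here $a\in A$ acts by composition with $\phi_a$ on the right, and $l\in L$ by composition on the left with multiplication by $l$). Let $\mathbb{T}=A\hat\otimes\mathbb{C}_\infty$ be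 the completion of $A\otimes\mathbb{C}_\infty$ for the norm $\|x\|=\inf\max_i|v_i|$, the infimum being over all representations $x=\sum_i a_i\otimes v_i$, and let $\omega\mapsto\omega^{(1)}$ be the continuous extension to $\mathbb{T}$ of $a\otimes v\mapsto a\otimes v^q$. Let $\kappa:E\to\mathbb{G}_{a,L}$ be any isomorphism of $\mathbb{F}$-vector space schemes over $L$. For $a\in A$ let $\phi_a^\kappa$ be the endomorphism of $\mathbb{G}_{a,L}$ corresponding to $\phi_a$ under $\kappa$ (on points, $x\mapsto\kappa(\phi_a(\kappa^{-1}(x)))$), and let $1\otimes\phi_a^\kappa$ be the continuous $A$-linear extension to $\mathbb{T}$ of the map it induces on $\mathbb{G}_a(\mathbb{C}_\infty)=\mathbb{C}_\infty$. Then there is a unique element $f_\kappa$ of the fraction field $Q$ of $A\otimes L$ (the shtuka function of $E$ associated to $\kappa$) such that $\operatorname{Frob}_q\circ\kappa=f_\kappa\cdot\kappa$ in $Q\otimes_{A\otimes L}\mathsf{M}$, where $\operatorname{Frob}_q$ is the $q$-Frobenius of $\mathbb{G}_{a,L}$, and the following subsets of $\mathbb{T}$ are equal: $$\{\omega\in\mathbb{T}\mid\forall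 a\in A:\ (1\otimes\phi_a^\kappa)(\omega)=(a\otimes1)\,\omega\}=\{\omega\in\mathbb{T}\mid\omega^{(1)}=f_\kappa\,\omega\},$$ where the equation $\omega^{(1)}=f_\kappa\,\omega$ is read in $Q\otimes_{A\otimes L}\mathbb{T}$, i.e. in the compositum of $Q$ and $\mathbb{T}$ inside the fraction field of $\mathbb{T}$. -/

import Mathlib

open CategoryTheory AlgebraicGeometry
open scoped TensorProduct

universe u

noncomputable section

namespace DrinfeldHayes

/-! ### `𝔽`-vector space schemes -/

/-- An `𝔽`-vector space scheme over `S`: an `S`-scheme whose functor of points takes values in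
`𝔽`-vector spaces (by Yoneda: a commutative group scheme with compatible `𝔽`-multiplication). -/
structure VectScheme (F : Type u) [Field F] (S : Scheme.{u}) where
  toOver : Over S
  addCommGroup : ∀ T : Over S, AddCommGroup (T ⟶ toOver)
  module : ∀ T : Over S, Module F (T ⟶ toOver)
  comp_add : ∀ {T T' : Over S} (g : T' ⟶ T) (x y : T ⟶ toOver),
    g ≫ (x + y) = g ≫ x + g ≫ y
  comp_smul : ∀ {T T' : Over S} (g : T' ⟶ T) (c : F) (x : T ⟶ toOver),
    g ≫ (c • x) = c • (g ≫ x)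

attribute [instance] VectScheme.addCommGroup VectScheme.module

namespace VectScheme

variable {F : Type u} [Field F] {S : Scheme.{u}}

/-- Precomposition with a morphism of test schemes, as a linear map on points. -/
def pullPoints (E : VectScheme F S) {T T' : Over S} (g : T' ⟶ T) :
    (T ⟶ E.toOver) →ₗ[F] (T' ⟶ E.toOver) where
  toFun x := g ≫ x
  map_add' := E.comp_add g
  map_smul' := E.comp_smul g

/-- Morphisms of `𝔽`-vector space schemes: the morphisms of `S`-schemes that are `𝔽`-linear on
points. They form an `𝔽`-vector space for the pointwise operations. -/
def homSubmodule (E E' : VectScheme F S) : Submodule F (E.toOver ⟶ E'.toOver) where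
  carrier := {h | (∀ (T : Over S) (x y : T ⟶ E.toOver), (x + y) ≫ h = x ≫ h + y ≫ h) ∧
    ∀ (T : Over S) (c : F) (x : T ⟶ E.toOver), (c • x) ≫ h = c • (x ≫ h)}
  add_mem' {f g} hf hg :=
    ⟨fun T x y => by simp only [comp_add, hf.1, hg.1]; abel,
     fun T c x => by simp only [comp_add, hf.2, hg.2, smul_add]⟩
  zero_mem' :=
    ⟨fun T x y => by
      have h (z : T ⟶ E.toOver) : z ≫ (0 : E.toOver ⟶ E'.toOver) = 0 :=
        map_zero (E'.pullPoints z)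
      simp [h],
     fun T c x => by
      have h (z : T ⟶ E.toOver) : z ≫ (0 : E.toOver ⟶ E'.toOver) = 0 :=
        map_zero (E'.pullPoints z)
      simp [h]⟩
  smul_mem' d f hf :=
    ⟨fun T x y => by simp only [comp_smul, hf.1, smul_add],
     fun T c x => by simp only [comp_smul, hf.2, smul_comm c d]⟩

instance : Category (VectScheme F S) where
  Hom E E' := homSubmodule E E'
  id E := ⟨𝟙 _, fun T x y => by simp, fun T c x => by simp⟩
  comp f g := ⟨f.1 ≫ g.1,
    fun T x y => by rw [← Category.assoc, f.2.1, g.2.1]; simp,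
    fun T c x => by rw [← Category.assoc, f.2.2, g.2.2]; simp⟩
  id_comp f := Subtype.ext (Category.id_comp f.1)
  comp_id f := Subtype.ext (Category.comp_id f.1)
  assoc f g h := Subtype.ext (Category.assoc f.1 g.1 h.1)

/-- The morphism of `S`-schemes underlying a morphism of `𝔽`-vector space schemes. -/
def hom {E E' : VectScheme F S} (f : E ⟶ E') : E.toOver ⟶ E'.toOver := f.1

@[ext]
theorem hom_ext {E E' : VectScheme F S} {f g : E ⟶ E'} (h : hom f = hom g) : f = g :=
  Subtype.ext h

@[simp] theorem id_hom (E : VectScheme F S) : hom (𝟙 E) = 𝟙 E.toOver := rfl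

@[simp] theorem comp_hom {E E' E'' : VectScheme F S} (f : E ⟶ E') (g : E' ⟶ E'') :
    hom (f ≫ g) = hom f ≫ hom g := rfl

/-- Postcomposition with a morphism, as a linear map on `T`-points. -/
def onPoints {E E' : VectScheme F S} (f : E ⟶ E') (T : Over S) :
    (T ⟶ E.toOver) →ₗ[F] (T ⟶ E'.toOver) where
  toFun x := x ≫ hom f
  map_add' := f.2.1 T
  map_smul' := f.2.2 T

instance (E E' : VectScheme F S) : AddCommGroup (E ⟶ E') :=
  (homSubmodule E E').addCommGroup

instance (E E' : VectScheme F S) : Module F (E ⟶ E') :=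
  (homSubmodule E E').module

@[simp] theorem add_hom {E E' : VectScheme F S} (f g : E ⟶ E') :
    hom (f + g) = hom f + hom g := rfl

@[simp] theorem smul_hom {E E' : VectScheme F S} (c : F) (f : E ⟶ E') :
    hom (c • f) = c • hom f := rfl

theorem add_comp' {E E' : VectScheme F S} (f : E ⟶ E') {T : Over S} (x y : T ⟶ E.toOver) :
    (x + y) ≫ hom f = x ≫ hom f + y ≫ hom f := f.2.1 T x y

theorem smul_comp' {E E' : VectScheme F S} (f : E ⟶ E') {T : Over S} (c : F)
    (x : T ⟶ E.toOver) : (c • x) ≫ hom f = c • (x ≫ hom f) := f.2.2 T c x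

instance : Preadditive (VectScheme F S) where
  homGroup E E' := inferInstance
  add_comp P Q R f g h := hom_ext (by
    simp only [comp_hom, add_hom, add_comp'])
  comp_add P Q E f g h := hom_ext (by
    simp only [comp_hom, add_hom, comp_add])

instance : Linear F (VectScheme F S) where
  homModule E E' := inferInstanceAs (Module F (E ⟶ E'))
  smul_comp P Q R c f g := hom_ext (by
    rw [comp_hom, smul_hom, smul_hom, smul_comp', comp_hom])
  comp_smul P Q E f c g := hom_ext (by
    rw [comp_hom, smul_hom, smul_hom, comp_smul, comp_hom])

end VectScheme

/-! ### Affine test schemes and Lie algebras -/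

section Affine

variable (L : Type u) [Field L]

/-- `Spec B` as a scheme over `Spec L`, for an `L`-algebra `B`. -/
abbrev specOver (B : Type u) [CommRing B] [Algebra L B] : Over (Spec (CommRingCat.of L)) :=
  Over.mk (Spec.map (CommRingCat.ofHom (algebraMap L B)))

variable {L}

/-- The morphism `Spec B' ⟶ Spec B` of `L`-schemes induced by `B →ₐ[L] B'`. -/
def specOverMap {B B' : Type u} [CommRing B] [Algebra L B] [CommRing B'] [Algebra L B']
    (f : B →ₐ[L] B') : specOver L B' ⟶ specOver L B :=
  Over.homMk (Spec.map (CommRingCat.ofHom f.toRingHom)) (by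
    simp only [Over.mk_left, Over.mk_hom, ← Spec.map_comp, ← CommRingCat.ofHom_comp]
    congr 2
    exact f.comp_algebraMap)

variable {F : Type u} [Field F]

/-- `Lie_E(L)`, the tangent space at the neutral element: the kernel of `E(L[ε]) → E(L)`,
`ε ↦ 0`. -/
def Lie (E : VectScheme F (Spec (CommRingCat.of L))) :
    AddSubgroup (specOver L (DualNumber L) ⟶ E.toOver) :=
  (E.pullPoints (specOverMap (TrivSqZeroExt.fstHom L L L))).toAddMonoidHom.ker

/-- The map `∂f : Lie_E(L) → Lie_E(L)` induced by an endomorphism `f` of `E`. -/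
def lieMap {E : VectScheme F (Spec (CommRingCat.of L))} (f : E ⟶ E) :
    AddMonoid.End (Lie E) :=
  ((VectScheme.onPoints f _).toAddMonoidHom.comp (Lie E).subtype).codRestrict (Lie E) (by
    rintro ⟨x, hx⟩
    change _ ≫ (x ≫ VectScheme.hom f) = 0
    have hx' : specOverMap (TrivSqZeroExt.fstHom L L L) ≫ x = 0 := hx
    rw [← Category.assoc, hx']
    exact map_zero (VectScheme.onPoints f _))

/-- Multiplication by the scalar `l : L` on `Lie_E(L)`, induced by `ε ↦ l ε` on `L[ε]`. -/
def lieScalar (E : VectScheme F (Spec (CommRingCat.of L))) (l : L) :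
    AddMonoid.End (Lie E) :=
  ((E.pullPoints (specOverMap (TrivSqZeroExt.map (l • LinearMap.id)))).toAddMonoidHom.comp
      (Lie E).subtype).codRestrict (Lie E) (by
    rintro ⟨x, hx⟩
    change _ ≫ (_ ≫ x) = 0
    have hx' : specOverMap (TrivSqZeroExt.fstHom L L L) ≫ x = 0 := hx
    have h : specOverMap (TrivSqZeroExt.fstHom L L L) ≫
        specOverMap (TrivSqZeroExt.map (l • (LinearMap.id : L →ₗ[L] L))) =
        specOverMap (TrivSqZeroExt.fstHom L L L) := by
      ext : 1
      simp only [specOverMap, Over.comp_left, Over.homMk_left, ← Spec.map_comp,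
        ← CommRingCat.ofHom_comp]
      congr 2
      exact RingHom.ext fun y => by simp
    rw [← Category.assoc, h, hx'])

end Affine

/-! ### The additive group `𝔾_{a,L}` -/

namespace Ga

variable (F L : Type u) [Field F] [Field L] [Algebra F L]

/-- The ring homomorphism `L → Γ(T)` of a scheme `T` over `Spec L`. -/
def structHom {L : Type u} [Field L] (T : Over (Spec (CommRingCat.of L))) : L →+* Γ(T.left, ⊤) :=
  ((Scheme.ΓSpecIso (CommRingCat.of L)).inv ≫ T.hom.appTop).hom

/-- The affine line over `Spec L`. -/
def line (L : Type u) [Field L] : Over (Spec (CommRingCat.of L)) :=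
  Over.mk (𝔸(PUnit.{u + 1}; Spec (CommRingCat.of L)) ↘ Spec (CommRingCat.of L))

/-- The `T`-points of the affine line are the global functions on `T`. -/
def coordEquiv {L : Type u} [Field L] (T : Over (Spec (CommRingCat.of L))) :
    (T ⟶ line L) ≃ Γ(T.left, ⊤) where
  toFun x := x.left.appTop (AffineSpace.coord _ PUnit.unit)
  invFun s := Over.homMk (AffineSpace.homOfVector T.hom (fun _ => s))
    (AffineSpace.homOfVector_over _ _)
  left_inv x := by
    ext : 1
    apply AffineSpace.hom_ext
    · exact (AffineSpace.homOfVector_over _ _).trans (Over.w x).symm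
    · intro i
      exact AffineSpace.homOfVector_appTop_coord _ _ _
  right_inv s := AffineSpace.homOfVector_appTop_coord _ _ _

theorem coordEquiv_comp {L : Type u} [Field L] {T T' : Over (Spec (CommRingCat.of L))}
    (g : T' ⟶ T) (x : T ⟶ line L) :
    coordEquiv T' (g ≫ x) = g.left.appTop.hom (coordEquiv T x) := rfl

theorem appTop_structHom {L : Type u} [Field L] {T T' : Over (Spec (CommRingCat.of L))}
    (g : T' ⟶ T) (l : L) : g.left.appTop.hom (structHom T l) = structHom T' l := by
  have h := congrArg Scheme.Hom.appTop (Over.w g)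
  rw [Scheme.Hom.comp_appTop] at h
  simp only [structHom, ← h]
  rfl

/-- `Γ(T)` as an `𝔽`-algebra, for `T` over `Spec L`. -/
abbrev gammaAlgebra (T : Over (Spec (CommRingCat.of L))) : Algebra F Γ(T.left, ⊤) :=
  ((structHom T).comp (algebraMap F L)).toAlgebra

/-- The additive group `𝔾_{a,L}` as an `𝔽`-vector space scheme: on `T`-points it is the `𝔽`-vector
space `Γ(T)`. -/
def additive : VectScheme F (Spec (CommRingCat.of L)) where
  toOver := line L
  addCommGroup T := (coordEquiv T).addCommGroup
  module T :=
    letI := gammaAlgebra F L T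
    letI := (coordEquiv T).addCommGroup
    (coordEquiv T).module F
  comp_add {T T'} g x y := by
    let := (coordEquiv T).addCommGroup
    let := (coordEquiv T').addCommGroup
    apply (coordEquiv T').injective
    have h1 : coordEquiv T (x + y) = coordEquiv T x + coordEquiv T y :=
      (coordEquiv T).apply_symm_apply _
    have h2 : coordEquiv T' (g ≫ x + g ≫ y) = coordEquiv T' (g ≫ x) + coordEquiv T' (g ≫ y) :=
      (coordEquiv T').apply_symm_apply _
    rw [h2, coordEquiv_comp, h1, map_add, coordEquiv_comp, coordEquiv_comp]
  comp_smul {T T'} g c x := by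
    apply (coordEquiv T').injective
    have h (T : Over (Spec (CommRingCat.of L))) (x : T ⟶ line L) :
        coordEquiv T (letI := gammaAlgebra F L T
          letI := (coordEquiv T).addCommGroup
          letI := (coordEquiv T).module F
          c • x) = structHom T (algebraMap F L c) * coordEquiv T x :=
      (coordEquiv T).apply_symm_apply _
    refine Eq.trans ?_ (h T' (g ≫ x)).symm
    rw [coordEquiv_comp, coordEquiv_comp, ← appTop_structHom g, ← map_mul]
    exact congrArg _ (h T x)

variable {F L}

/-- The `T`-points of `𝔾_a` are `Γ(T)`, as `𝔽`-vector spaces. -/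
def coord (T : Over (Spec (CommRingCat.of L))) :
    letI := gammaAlgebra F L T
    (T ⟶ (additive F L).toOver) ≃ₗ[F] Γ(T.left, ⊤) :=
  letI := gammaAlgebra F L T
  { coordEquiv T with
    map_add' := fun _ _ => (coordEquiv T).apply_symm_apply _
    map_smul' := fun _ _ => (coordEquiv T).apply_symm_apply _ }

theorem coord_comp {T T' : Over (Spec (CommRingCat.of L))}
    (g : T' ⟶ T) (x : T ⟶ (additive F L).toOver) :
    coord T' (g ≫ x) = g.left.appTop.hom (coord T x) := rfl

/-- The endomorphism of `𝔾_a` given on `T`-points by a natural `𝔽`-linear endomorphism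
of `Γ(T)`. -/
def ofNatural
    (η : ∀ T : Over (Spec (CommRingCat.of L)),
      letI := gammaAlgebra F L T
      Γ(T.left, ⊤) →ₗ[F] Γ(T.left, ⊤))
    (hη : ∀ {T T' : Over (Spec (CommRingCat.of L))} (g : T' ⟶ T) (s : Γ(T.left, ⊤)),
      g.left.appTop.hom (η T s) = η T' (g.left.appTop.hom s)) :
    additive F L ⟶ additive F L :=
  have key : ∀ (T : Over (Spec (CommRingCat.of L))) (x : T ⟶ (additive F L).toOver),
      x ≫ (coord (F := F) _).symm (η _ (coord (F := F) _ (𝟙 (additive F L).toOver))) =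
        (coord (F := F) T).symm (η T (coord (F := F) T x)) := fun T x => by
    apply (coord (F := F) T).injective
    rw [coord_comp, LinearEquiv.apply_symm_apply, LinearEquiv.apply_symm_apply, hη,
      ← coord_comp, Category.comp_id]
  ⟨(coord (F := F) _).symm (η _ (coord (F := F) _ (𝟙 (additive F L).toOver))),
    fun T x y => by rw [key, key, key, map_add, map_add, map_add],
    fun T c x => by
      let := gammaAlgebra F L T
      rw [key, key, map_smul, map_smul, map_smul]⟩

theorem coord_comp_ofNatural
    (η : ∀ T : Over (Spec (CommRingCat.of L)),
      letI := gammaAlgebra F L T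
      Γ(T.left, ⊤) →ₗ[F] Γ(T.left, ⊤))
    (hη : ∀ {T T' : Over (Spec (CommRingCat.of L))} (g : T' ⟶ T) (s : Γ(T.left, ⊤)),
      g.left.appTop.hom (η T s) = η T' (g.left.appTop.hom s))
    (T : Over (Spec (CommRingCat.of L))) (x : T ⟶ (additive F L).toOver) :
    coord T (x ≫ VectScheme.hom (ofNatural η hη)) = η T (coord T x) := by
  change coord T (x ≫ (coord (F := F) _).symm (η _ (coord (F := F) _ (𝟙 (additive F L).toOver)))) = _
  rw [coord_comp, LinearEquiv.apply_symm_apply, hη, ← coord_comp, Category.comp_id]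

/-- Multiplication by `l : L` on `𝔾_{a,L}`, as an `𝔽`-algebra homomorphism `L → End(𝔾_{a,L})`. -/
def scalar : L →ₐ[F] End (additive F L) :=
  let σ (l : L) : End (additive F L) := ofNatural
    (fun T => letI := gammaAlgebra F L T
      LinearMap.mulLeft F (structHom T l))
    (fun {T T'} g s => by
      change g.left.appTop.hom (_ * _) = _ * _
      rw [map_mul, appTop_structHom])
  have hσ (l : L) (T : Over (Spec (CommRingCat.of L))) (x : T ⟶ (additive F L).toOver) :
      coord T (x ≫ VectScheme.hom (σ l)) = structHom T l * coord T x :=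
    coord_comp_ofNatural _ _ T x
  have ext (f g : End (additive F L))
      (h : coord _ (𝟙 _ ≫ VectScheme.hom f) = coord _ (𝟙 _ ≫ VectScheme.hom g)) : f = g :=
    VectScheme.hom_ext (by simpa using (coord _).injective h)
  { toFun := σ
    map_one' := ext _ _ (by
      rw [hσ, map_one, one_mul]; rfl)
    map_mul' := fun a b => ext _ _ (by
      change _ = coord _ (𝟙 _ ≫ (VectScheme.hom (σ b) ≫ VectScheme.hom (σ a)))
      rw [← Category.assoc, hσ, hσ, hσ, map_mul, mul_assoc])
    map_zero' := ext _ _ (by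
      rw [hσ, map_zero, zero_mul]
      change 0 = coord _ (𝟙 _ ≫ (0 : (additive F L).toOver ⟶ (additive F L).toOver))
      rw [Category.id_comp, map_zero])
    map_add' := fun a b => ext _ _ (by
      change _ = coord _ (𝟙 _ ≫ (VectScheme.hom (σ a) + VectScheme.hom (σ b)))
      rw [VectScheme.comp_add, map_add, hσ, hσ, hσ, map_add, add_mul])
    commutes' := fun c => ext _ _ (by
      rw [hσ]
      change _ = coord _ (𝟙 _ ≫ (c • 𝟙 (additive F L).toOver))
      let := gammaAlgebra F L (additive F L).toOver
      rw [VectScheme.comp_smul, map_smul, Category.comp_id, Algebra.smul_def]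
      rfl) }

/-- The `q`-Frobenius endomorphism of `𝔾_{a,L}`, `x ↦ x ^ q` on points, where `q = #𝔽`. -/
def frob [Fintype F] : additive F L ⟶ additive F L :=
  ofNatural
    (fun T => letI := gammaAlgebra F L T
      (FiniteField.frobeniusAlgHom F Γ(T.left, ⊤)).toLinearMap)
    (fun {T T'} g s => by
      change g.left.appTop.hom (s ^ _) = (g.left.appTop.hom s) ^ _
      rw [map_pow])

/-- For an `L`-algebra `B`, the identification `𝔾_a(B) = B`. -/
def pointsEquiv (B : Type u) [CommRing B] [Algebra L B] [Algebra F B] [IsScalarTower F L B] :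
    (specOver L B ⟶ (additive F L).toOver) ≃ₗ[F] B :=
  letI := gammaAlgebra F L (specOver L B)
  (coord (specOver L B)).trans
    { (Scheme.ΓSpecIso (CommRingCat.of B)).commRingCatIsoToRingEquiv with
      map_smul' := fun c s => by
        have h (l : L) : (Scheme.ΓSpecIso (CommRingCat.of B)).hom.hom
            (structHom (specOver L B) l) = algebraMap L B l := by
          have h1 := Scheme.ΓSpecIso_naturality (CommRingCat.ofHom (algebraMap L B))
          have h2 : (Scheme.ΓSpecIso (CommRingCat.of L)).inv ≫
              (Spec.map (CommRingCat.ofHom (algebraMap L B))).appTop ≫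
                (Scheme.ΓSpecIso (CommRingCat.of B)).hom = CommRingCat.ofHom (algebraMap L B) := by
            rw [h1, Iso.inv_hom_id_assoc]
          exact congrArg (fun f => f.hom l) h2
        change (Scheme.ΓSpecIso (CommRingCat.of B)).hom.hom
          (structHom (specOver L B) (algebraMap F L c) * s) =
            c • (Scheme.ΓSpecIso (CommRingCat.of B)).hom.hom s
        rw [map_mul, h, ← IsScalarTower.algebraMap_apply, Algebra.smul_def] }

/-- The `𝔽`-linear map `B → B` induced on `B`-points by an endomorphism of `𝔾_{a,L}`. -/
def onB (g : additive F L ⟶ additive F L)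
    (B : Type u) [CommRing B] [Algebra L B] [Algebra F B] [IsScalarTower F L B] : B →ₗ[F] B :=
  (pointsEquiv B).toLinearMap ∘ₗ VectScheme.onPoints g _ ∘ₗ (pointsEquiv B).symm.toLinearMap

end Ga

/-! ### Anderson modules of dimension one and their motives -/

section Anderson

variable {F A L : Type u} [Field F] [CommRing A] [Algebra F A] [Field L] [Algebra F L]

/-- An Anderson `A`-module of dimension one over `L`, where `ℓ : A → L` is the structure map. -/
structure AndersonModule (ℓ : A →ₐ[F] L) where
  E : VectScheme F (Spec (CommRingCat.of L))
  nonempty_iso : Nonempty (E ≅ Ga.additive F L)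
  φ : A →ₐ[F] End E
  isNilpotent_lie : ∀ a : A, IsNilpotent (lieMap (φ a) - lieScalar E (ℓ a))

namespace AndersonModule

variable {ℓ : A →ₐ[F] L} (D : AndersonModule ℓ)

/-- The `A`-motive `M(E) = Hom(E, 𝔾_a)` of an Anderson module. -/
def Motive : Type u := D.E ⟶ Ga.additive F L

instance : AddCommGroup D.Motive := inferInstanceAs (AddCommGroup (D.E ⟶ Ga.additive F L))

instance : Module F D.Motive := inferInstanceAs (Module F (D.E ⟶ Ga.additive F L))

/-- `a : A` acts on the motive by composition with `φ_a` on the right. -/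
instance : Module A D.Motive where
  smul a m := (show D.E ⟶ D.E from D.φ a) ≫ (show D.E ⟶ Ga.additive F L from m)
  one_smul m := by
    change (show D.E ⟶ D.E from D.φ 1) ≫ (show D.E ⟶ Ga.additive F L from m) = m
    rw [map_one]; exact Category.id_comp _
  mul_smul a b m := by
    change (show D.E ⟶ D.E from D.φ (a * b)) ≫ (show D.E ⟶ Ga.additive F L from m) =
      (show D.E ⟶ D.E from D.φ a) ≫ (show D.E ⟶ D.E from D.φ b) ≫
        (show D.E ⟶ Ga.additive F L from m)
    rw [mul_comm, map_mul]; exact Category.assoc _ _ _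
  smul_zero a := Limits.comp_zero
  smul_add a m n := Preadditive.comp_add _ _ _ _ _ _
  add_smul a b m := by
    change (show D.E ⟶ D.E from D.φ (a + b)) ≫ (show D.E ⟶ Ga.additive F L from m) = _
    rw [map_add]; exact Preadditive.add_comp _ _ _ _ _ _
  zero_smul m := by
    change (show D.E ⟶ D.E from D.φ 0) ≫ (show D.E ⟶ Ga.additive F L from m) = _
    rw [map_zero]; exact Limits.zero_comp

/-- `l : L` acts on the motive by composition on the left with multiplication by `l`. -/
instance : Module L D.Motive where
  smul l m := (show D.E ⟶ Ga.additive F L from m) ≫ Ga.scalar l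
  one_smul m := by
    change (show D.E ⟶ Ga.additive F L from m) ≫ Ga.scalar (F := F) (1 : L) = m
    rw [map_one]; exact Category.comp_id _
  mul_smul a b m := by
    change (show D.E ⟶ Ga.additive F L from m) ≫ Ga.scalar (F := F) (a * b) =
      ((show D.E ⟶ Ga.additive F L from m) ≫ Ga.scalar (F := F) b) ≫ Ga.scalar (F := F) a
    rw [map_mul]; exact (Category.assoc _ _ _).symm
  smul_zero a := Limits.zero_comp
  smul_add a m n := Preadditive.add_comp _ _ _ _ _ _
  add_smul a b m := by
    change (show D.E ⟶ Ga.additive F L from m) ≫ Ga.scalar (F := F) (a + b) = _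
    rw [map_add]; exact Preadditive.comp_add _ _ _ _ _ _
  zero_smul m := by
    change (show D.E ⟶ Ga.additive F L from m) ≫ Ga.scalar (F := F) (0 : L) = _
    rw [map_zero]; exact Limits.comp_zero

instance : IsScalarTower F A D.Motive where
  smul_assoc c a m := by
    change (show D.E ⟶ D.E from D.φ (c • a)) ≫ (show D.E ⟶ Ga.additive F L from m) = _
    rw [map_smul]; exact Linear.smul_comp _ _ _ _ _ _

instance : IsScalarTower F L D.Motive where
  smul_assoc c l m := by
    change (show D.E ⟶ Ga.additive F L from m) ≫ Ga.scalar (F := F) (c • l) = _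
    rw [map_smul]; exact Linear.comp_smul _ _ _ _ _ _

instance : SMulCommClass A L D.Motive where
  smul_comm _ _ _ := (Category.assoc _ _ _).symm

/-- The `A ⊗ L`-module structure of the motive. -/
instance : Module (A ⊗[F] L) D.Motive := TensorProduct.Algebra.module

/-- `E` is abelian of rank one, that is, `E` is a Drinfeld–Hayes module: its motive is a finitely
generated `A ⊗ L`-module of rank one. -/
structure IsDrinfeldHayes : Prop where
  finite : Module.Finite (A ⊗[F] L) D.Motive
  finrank_eq_one : Module.finrank (A ⊗[F] L) D.Motive = 1

variable {D}

/-- A coordinate `κ : E ≅ 𝔾_a`, seen as an element of the motive. -/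
def coordMotive (κ : D.E ≅ Ga.additive F L) : D.Motive := κ.hom

/-- The element `Frob_q ∘ κ` of the motive. -/
def frobCoordMotive [Fintype F] (κ : D.E ≅ Ga.additive F L) : D.Motive := κ.hom ≫ Ga.frob

/-- `f` is a shtuka function for `κ`: an element of the fraction field `Q` of `A ⊗ L` such that
`Frob_q ∘ κ = f · κ`, an identity in `Q ⊗ M(E)`. -/
def IsShtukaFunction [Fintype F] (κ : D.E ≅ Ga.additive F L) (f : FractionRing (A ⊗[F] L)) :
    Prop :=
  ((1 : FractionRing (A ⊗[F] L)) ⊗ₜ[A ⊗[F] L] frobCoordMotive κ :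
      FractionRing (A ⊗[F] L) ⊗[A ⊗[F] L] D.Motive) =
    f • ((1 : FractionRing (A ⊗[F] L)) ⊗ₜ[A ⊗[F] L] coordMotive κ)

/-- The endomorphism `φ_a^κ` of `𝔾_a` corresponding to `φ_a` under `κ : E ≅ 𝔾_a`: on points,
`x ↦ κ (φ_a (κ⁻¹ x))`. -/
def phiCoord (κ : D.E ≅ Ga.additive F L) (a : A) : Ga.additive F L ⟶ Ga.additive F L :=
  κ.inv ≫ (show D.E ⟶ D.E from D.φ a) ≫ κ.hom

end AndersonModule

end Anderson

/-! ### The general Tate algebra -/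

section Tate

/-- The tensor product `A ⊗ V`, to be equipped with the Gauss norm. -/
def PreTate (F A V : Type u) [Field F] [CommRing A] [Algebra F A] [NormedField V] [Algebra F V] :
    Type u := A ⊗[F] V

namespace PreTate

variable {F A V : Type u} [Field F] [CommRing A] [Algebra F A] [NormedField V] [Algebra F V]

instance : CommRing (PreTate F A V) := inferInstanceAs (CommRing (A ⊗[F] V))

/-- Elementary tensors. -/
def tmul (a : A) (v : V) : PreTate F A V := a ⊗ₜ[F] v

theorem tmul_mul_tmul (a b : A) (v w : V) :
    (tmul a v * tmul b w : PreTate F A V) = tmul (a * b) (v * w) :=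
  Algebra.TensorProduct.tmul_mul_tmul a b v w

/-- The elements of `A ⊗ V` that have a representation `∑ i, a_i ⊗ v_i` (a finite sum) with
`max_i ‖v_i‖ ≤ r`. -/
def level (r : ℝ) : AddSubmonoid (PreTate F A V) :=
  AddSubmonoid.closure {x | ∃ (a : A) (v : V), ‖v‖ ≤ r ∧ x = tmul a v}

theorem level_mono {r s : ℝ} (h : r ≤ s) :
    (level r : AddSubmonoid (PreTate F A V)) ≤ level s :=
  AddSubmonoid.closure_mono fun _ ⟨a, v, hv, hx⟩ => ⟨a, v, hv.trans h, hx⟩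

theorem exists_mem_level (x : PreTate F A V) : ∃ r : ℝ, 0 ≤ r ∧ x ∈ level r := by
  refine TensorProduct.induction_on (motive := fun x : A ⊗[F] V =>
    ∃ r : ℝ, 0 ≤ r ∧ (show PreTate F A V from x) ∈ level r) x
    ⟨0, le_rfl, zero_mem _⟩ (fun a v => ⟨‖v‖, norm_nonneg v,
      AddSubmonoid.subset_closure ⟨a, v, le_rfl, rfl⟩⟩) ?_
  rintro x y ⟨r, hr, hx⟩ ⟨s, -, hy⟩
  exact ⟨max r s, hr.trans (le_max_left _ _),
    add_mem (level_mono (le_max_left _ _) hx) (level_mono (le_max_right _ _) hy)⟩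

theorem neg_mem_level {r : ℝ} {x : PreTate F A V} (hx : x ∈ level r) : -x ∈ level r := by
  induction hx using AddSubmonoid.closure_induction with
  | mem x h =>
    obtain ⟨a, v, hv, rfl⟩ := h
    exact AddSubmonoid.subset_closure ⟨-a, v, hv, (TensorProduct.neg_tmul a v).symm⟩
  | zero => rw [neg_zero]; exact zero_mem _
  | add x y _ _ hx hy => rw [neg_add]; exact add_mem hx hy

theorem mul_mem_level {r s : ℝ} (hr : 0 ≤ r) {x y : PreTate F A V} (hx : x ∈ level r)
    (hy : y ∈ level s) : x * y ∈ level (r * s) := by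
  induction hx using AddSubmonoid.closure_induction with
  | zero => rw [zero_mul]; exact zero_mem _
  | add x x' _ _ hx hx' => rw [add_mul]; exact add_mem hx hx'
  | mem x h =>
    obtain ⟨a, v, hv, rfl⟩ := h
    induction hy using AddSubmonoid.closure_induction with
    | zero => rw [mul_zero]; exact zero_mem _
    | add y y' _ _ hy hy' => rw [mul_add]; exact add_mem hy hy'
    | mem y h =>
      obtain ⟨b, w, hw, rfl⟩ := h
      refine AddSubmonoid.subset_closure ⟨a * b, v * w, ?_, tmul_mul_tmul a b v w⟩
      rw [norm_mul]
      exact mul_le_mul hv hw (norm_nonneg _) hr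

/-- The norm `‖x‖ = inf (max_i ‖v_i‖)` on `A ⊗ V`, the infimum being over all representations
`x = ∑ i, a_i ⊗ v_i`. -/
def gaussNorm (x : PreTate F A V) : ℝ := sInf {r : ℝ | 0 ≤ r ∧ x ∈ level r}

theorem gaussNorm_nonneg (x : PreTate F A V) : 0 ≤ gaussNorm x :=
  Real.sInf_nonneg fun _ h => h.1

theorem gaussNorm_le {x : PreTate F A V} {r : ℝ} (hr : 0 ≤ r) (hx : x ∈ level r) :
    gaussNorm x ≤ r :=
  csInf_le ⟨0, fun _ h => h.1⟩ ⟨hr, hx⟩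

theorem mem_level_of_gaussNorm_lt {x : PreTate F A V} {r : ℝ} (h : gaussNorm x < r) :
    x ∈ level r := by
  obtain ⟨s, hs, hsr⟩ := exists_lt_of_csInf_lt (exists_mem_level x) h
  exact level_mono hsr.le hs.2

/-- The Gauss norm as a ring seminorm. -/
def gaussSeminorm : RingSeminorm (PreTate F A V) where
  toFun := gaussNorm
  map_zero' := le_antisymm (gaussNorm_le le_rfl (zero_mem _)) (gaussNorm_nonneg _)
  add_le' x y := by
    refine le_of_forall_pos_le_add fun ε hε => ?_
    have hx := mem_level_of_gaussNorm_lt (lt_add_of_pos_right (gaussNorm x) hε)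
    have hy := mem_level_of_gaussNorm_lt (lt_add_of_pos_right (gaussNorm y) hε)
    have h0 := gaussNorm_nonneg x
    have h1 := gaussNorm_nonneg y
    exact gaussNorm_le (by positivity)
      (add_mem (level_mono (by linarith) hx) (level_mono (by linarith) hy))
  neg' x := by
    simp only [gaussNorm]
    congr 1
    ext r
    exact and_congr_right fun _ =>
      ⟨fun h => by simpa using neg_mem_level h, fun h => neg_mem_level h⟩
  mul_le' x y := by
    have h0 := gaussNorm_nonneg x
    have h1 := gaussNorm_nonneg y
    have key : ∀ ε > 0, gaussNorm (x * y) ≤ (gaussNorm x + ε) * (gaussNorm y + ε) := fun ε hε =>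
      gaussNorm_le (by positivity) (mul_mem_level (by positivity)
        (mem_level_of_gaussNorm_lt (lt_add_of_pos_right _ hε))
        (mem_level_of_gaussNorm_lt (lt_add_of_pos_right _ hε)))
    have hc : Filter.Tendsto (fun ε : ℝ => (gaussNorm x + ε) * (gaussNorm y + ε))
        (nhdsWithin 0 (Set.Ioi 0)) (nhds (gaussNorm x * gaussNorm y)) := by
      have : Continuous fun ε : ℝ => (gaussNorm x + ε) * (gaussNorm y + ε) := by fun_prop
      simpa using (this.tendsto 0).mono_left nhdsWithin_le_nhds
    exact ge_of_tendsto hc (Filter.eventually_of_mem self_mem_nhdsWithin key)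

instance : SeminormedCommRing (PreTate F A V) where
  __ := (gaussSeminorm : RingSeminorm (PreTate F A V)).toSeminormedRing
  mul_comm := mul_comm

end PreTate

variable (F A V : Type u) [Field F] [CommRing A] [Algebra F A] [NormedField V] [Algebra F V]

/-- The completion of `A ⊗ V` with respect to the Gauss norm. For `V = ℂ_∞` this is the general
Tate algebra `𝕋`. -/
abbrev Tate : Type u := UniformSpace.Completion (PreTate F A V)

variable {F A V}

/-- The canonical map `A ⊗ V → 𝕋`. -/
def Tate.of : A ⊗[F] V →+* Tate F A V :=
  (UniformSpace.Completion.coeRingHom : PreTate F A V →+* Tate F A V)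

/-- For an `𝔽`-linear map `g : V → V`, the linear map `1 ⊗ g` on `A ⊗ V`. -/
def PreTate.map (g : V →ₗ[F] V) : PreTate F A V → PreTate F A V :=
  LinearMap.lTensor (M := A) g

/-- For continuous `g`, the map `1 ⊗ g` is uniformly continuous for the Gauss norm, so that it
extends to the completion. -/
theorem PreTate.uniformContinuous_map (g : V →ₗ[F] V) (hg : Continuous g) :
    UniformContinuous (PreTate.map g : PreTate F A V → PreTate F A V) := by
  rw [Metric.uniformContinuous_iff]
  intro ε hε
  obtain ⟨δ, hδ, h⟩ := Metric.continuousAt_iff.1 (hg.continuousAt (x := 0)) (ε / 2) (half_pos hε)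
  refine ⟨δ, hδ, fun {x y} hxy => ?_⟩
  have hmap (x y : PreTate F A V) : PreTate.map g (x - y) = PreTate.map g x - PreTate.map g y :=
    map_sub (LinearMap.lTensor (M := A) g) x y
  rw [dist_eq_norm] at hxy ⊢
  rw [← hmap]
  generalize x - y = z at hxy ⊢
  obtain ⟨r, hr, hrδ⟩ := exists_lt_of_csInf_lt (PreTate.exists_mem_level z) hxy
  refine lt_of_le_of_lt (PreTate.gaussNorm_le (half_pos hε).le ?_) (half_lt_self hε)
  obtain ⟨-, hz⟩ := hr
  clear hxy
  induction hz using AddSubmonoid.closure_induction with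
  | mem z hz =>
    obtain ⟨a, v, hv, rfl⟩ := hz
    refine AddSubmonoid.subset_closure ⟨a, g v, ?_, LinearMap.lTensor_tmul A g a v⟩
    have := h (show dist v 0 < δ by rw [dist_zero_right]; exact hv.trans_lt hrδ)
    rw [map_zero, dist_zero_right] at this
    exact this.le
  | zero => exact (map_zero (LinearMap.lTensor (M := A) g)).symm ▸ zero_mem _
  | add z w _ _ hz hw =>
    have h' : (PreTate.map g (z + w) : PreTate F A V) = PreTate.map g z + PreTate.map g w :=
      map_add (LinearMap.lTensor (M := A) g) z w
    rw [h']
    exact add_mem hz hw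

/-- The continuous extension `1 ⊗ g : 𝕋 → 𝕋` of the `A`-linear map `1 ⊗ g`, for a continuous
`𝔽`-linear `g : V → V`. -/
def Tate.map (g : V →ₗ[F] V) : Tate F A V → Tate F A V :=
  UniformSpace.Completion.map (PreTate.map g)

/-- The Frobenius twist `ω ↦ ω^{(1)}` on `𝕋`, which extends `a ⊗ v ↦ a ⊗ v ^ q`. -/
def Tate.twist [Fintype F] (ω : Tate F A V) : Tate F A V :=
  Tate.map (FiniteField.frobeniusAlgHom F V).toLinearMap ω

/-- `𝕋` as an algebra over `A ⊗ L`, for a subfield `L` of `V`. As `𝕋` is a domain containing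
`A ⊗ L`, the tensor product `Q ⊗ 𝕋` over `A ⊗ L`, for `Q` the fraction field of `A ⊗ L`, is the
compositum of `Q` and `𝕋` in the fraction field of `𝕋`. -/
instance Tate.algebra {L : Type u} [Field L] [Algebra F L] [Algebra L V] [IsScalarTower F L V] :
    Algebra (A ⊗[F] L) (Tate F A V) :=
  (Tate.of.comp (Algebra.TensorProduct.map (AlgHom.id F A)
    (IsScalarTower.toAlgHom F L V)).toRingHom).toAlgebra

end Tate

/-! ### The curve, its point at infinity, and the field `ℂ_∞` -/

/-- On an integral scheme with one point, the functions on an affine open form a field. -/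
theorem isField_of_subsingleton {X : Scheme.{u}} [AlgebraicGeometry.IsIntegral X]
    [Subsingleton X] {V : X.Opens} (hV : IsAffineOpen V) [Nonempty V] : IsField Γ(X, V) := by
  have : Subsingleton V := inferInstanceAs (Subsingleton (V : Set X))
  have hs : Subsingleton (PrimeSpectrum Γ(X, V)) :=
    (hV.isoSpec.hom.homeomorph.symm.toEquiv : (Spec Γ(X, V)) ≃ V).subsingleton
  by_contra h
  obtain ⟨p, hp, hp'⟩ := Ring.not_isField_iff_exists_prime.mp h
  have := congrArg PrimeSpectrum.asIdeal
    (Subsingleton.elim (⟨p, hp'⟩ : PrimeSpectrum Γ(X, V)) ⟨⊥, Ideal.isPrime_bot⟩)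
  exact hp this

/-- A field is never standard smooth of relative dimension one over a field. -/
theorem not_isStandardSmooth_one {R B : Type u} [Field R] [Field B]
    (g : R →+* B) (hg : g.IsStandardSmoothOfRelativeDimension 1) : False := by
  algebraize [g]
  have := Algebra.IsStandardSmoothOfRelativeDimension.isStandardSmooth (R := R) (S := B) 1
  have : Module.Finite R B := finite_of_finite_type_of_isJacobsonRing R B
  obtain ⟨h, hh⟩ :=
    Algebra.IsStandardSmoothOfRelativeDimension.exists_etale_mvPolynomial 1 R B
  have hfl := (RingHom.Etale.iff_flat_and_formallyUnramified.1 hh).1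
  have hinj : Function.Injective h := by
    algebraize [h.toRingHom]
    exact FaithfulSMul.algebraMap_injective (MvPolynomial (Fin 1) R) B
  have : Module.Finite R (MvPolynomial (Fin 1) R) :=
    Module.Finite.of_injective h.toLinearMap hinj
  have h1 : IsIntegral R (MvPolynomial.X 0 : MvPolynomial (Fin 1) R) :=
    Algebra.IsIntegral.isIntegral _
  exact MvPolynomial.transcendental_X R 0 h1.isAlgebraic

/-- A smooth integral curve over a field has more than one point. -/
theorem exists_ne_of_smooth {F : Type u} [Field F] {X : Scheme.{u}}
    (f : X ⟶ Spec (CommRingCat.of F)) [AlgebraicGeometry.IsIntegral X]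
    [SmoothOfRelativeDimension 1 f] (x : X) :
    ∃ y : X, y ≠ x := by
  by_contra! h
  have : Subsingleton X := ⟨fun a b => (h a).trans (h b).symm⟩
  obtain ⟨U, hU, V, hV, hx, e, hf⟩ :=
    SmoothOfRelativeDimension.exists_isStandardSmoothOfRelativeDimension (n := 1) (f := f) x
  have : Nonempty V := ⟨⟨x, hx⟩⟩
  have : Nonempty U := ⟨⟨f x, e hx⟩⟩
  have : Subsingleton (Spec (CommRingCat.of F)) :=
    inferInstanceAs (Subsingleton (PrimeSpectrum F))
  let := (isField_of_subsingleton hV).toField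
  let := (isField_of_subsingleton hU).toField
  exact not_isStandardSmooth_one _ hf

/-- A smooth projective geometrically irreducible curve over `𝔽` with a closed point `∞`.
(For curves over a field, projective is the same as proper.) -/
structure PointedCurve (F : Type u) [Field F] where
  X : Scheme.{u}
  str : X ⟶ Spec (CommRingCat.of F)
  [isIntegral : AlgebraicGeometry.IsIntegral X]
  [isProper : IsProper str]
  [smooth : SmoothOfRelativeDimension 1 str]
  [geometricallyIrreducible : GeometricallyIrreducible str]
  infty : X
  isClosed_infty : IsClosed {infty}

namespace PointedCurve

attribute [instance] isIntegral isProper smooth geometricallyIrreducible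

variable {F : Type u} [Field F] (C : PointedCurve F)

/-- The open subscheme `C ∖ {∞}`. -/
def compl : C.X.Opens := ⟨{C.infty}ᶜ, C.isClosed_infty.isOpen_compl⟩

instance : Nonempty C.compl :=
  let ⟨y, hy⟩ := exists_ne_of_smooth C.str C.infty
  ⟨⟨y, hy⟩⟩

/-- The ring `A` of functions regular outside `∞`. -/
def A : Type u := Γ(C.X, C.compl)

instance : CommRing C.A := inferInstanceAs (CommRing Γ(C.X, C.compl))

instance : Algebra F C.A :=
  ((Scheme.ΓSpecIso (CommRingCat.of F)).inv ≫
    C.str.appLE ⊤ C.compl le_top).hom.toAlgebra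

/-- The function field of `C`. -/
def K : Type u := C.X.functionField

instance : Field C.K := inferInstanceAs (Field C.X.functionField)

instance : Algebra C.A C.K := inferInstanceAs (Algebra Γ(C.X, C.compl) C.X.functionField)

instance : Algebra F C.K := ((algebraMap C.A C.K).comp (algebraMap F C.A)).toAlgebra

instance : IsScalarTower F C.A C.K := .of_algebraMap_eq' rfl

/-- A place above `∞` of an algebraic closure of `K`: a non-archimedean absolute value whose
restriction to `K` has the local ring of `C` at `∞` as its valuation ring. -/
structure Place where
  v : AbsoluteValue (AlgebraicClosure C.K) ℝ
  isNonarchimedean : IsNonarchimedean v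
  le_one_iff : ∀ x : C.K, v (algebraMap C.K (AlgebraicClosure C.K) x) ≤ 1 ↔
    x ∈ (algebraMap (C.X.presheaf.stalk C.infty) C.X.functionField).range

variable {C}

/-- The field `ℂ_∞`: the completion of the algebraic closure of `K` at a place above `∞`. -/
abbrev Place.Cinf (P : C.Place) : Type u := P.v.Completion

variable {P : C.Place} (L : IntermediateField C.K P.Cinf)

instance : IsScalarTower F L P.Cinf := .of_algebraMap_eq' rfl

/-- The inclusion `ℓ : A → L`, for an intermediate field `K ⊆ L ⊆ ℂ_∞`. -/
def ell : C.A →ₐ[F] L :=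
  (IsScalarTower.toAlgHom F C.K L).comp (IsScalarTower.toAlgHom F C.A C.K)

end PointedCurve

end DrinfeldHayes

end

/-! Write `τ` for the `q`-Frobenius, `M` for the motive and `R = A ⊗ L`. Since `C` is geometrically
irreducible and `𝔽` is perfect, `A ⊗ k` is a domain for every field `k` over `𝔽`. Two consequences
are used. First, `R` has a fraction field `Q`. Second, taking for `k` the residue field of `ℂ_∞`,
the Gauss norm is multiplicative (Gauss's lemma), so `𝕋` is torsion-free over `R`.

The other basic input is that every endomorphism of `𝔾_a` is a polynomial in `τ` with coefficients
in `L` (`Ga.end_induction`). Hence every element of `M` is obtained from `κ` by sums, scalars and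
`τ`, and `τ` is semilinear for the injective twist of `R`. If `κ` were torsion, all of `M` would be
torsion, contradicting rank one. So `κ` spans `Q ⊗ M`, and `f_κ` exists and is unique.

Suppose `φ_a` acts on `ω` as `a` for all `a`. Then the evaluation `m ↦ (m ∘ κ⁻¹)(ω)` is `R`-linear
from `M` to `𝕋` (`evalMotive_smul`). It sends `κ` to `ω` and `τκ` to `ω^{(1)}`, so it carries the
relation defining `f_κ` to `ω^{(1)} = f_κ ω`.

Conversely, suppose `ω^{(1)} = f_κ ω`, and consider in `M × 𝕋` the elements proportional over `Q` to
`(κ, ω)`. They form a submodule containing `(τκ, ω^{(1)})`, hence stable under `τ`, hence containing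
`(g ∘ κ, g(ω))` for every endomorphism `g` of `𝔾_a`. For `g = φ_a^κ` the first entry is `a κ`. As
`κ` is not torsion and `𝕋` is torsion-free, the second entry is `a ω`. -/

noncomputable section

namespace DrinfeldHayes

/-! ### Endomorphisms of the additive group -/

/-! ### Exponents of additive polynomials over a finite field -/

section AdditivePolynomial

open Polynomial

variable {F L : Type u} [Field F] [Fintype F] [Field L] [Algebra F L]

/-- If all the inner binomial coefficients of `n > 0` vanish in an extension `L` of the finite
field `F` and `c ^ n = c` for all `c : F`, then `n` is a power of the cardinality of `F`. -/
theorem exists_eq_card_pow {n : ℕ} (hn : 0 < n)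
    (h : ∀ i, 0 < i → i < n → (n.choose i : L) = 0) (hc : ∀ c : F, c ^ n = c) :
    ∃ k, n = Fintype.card F ^ k := by
  obtain ⟨p, hp⟩ := CharP.exists F
  obtain ⟨e, hpp, he⟩ := FiniteField.card F p
  have := Fact.mk hpp
  have : CharP L p := charP_of_injective_algebraMap (algebraMap F L).injective p
  have hpow : n = p ^ multiplicity p n :=
    Choose.eq_pow_multiplicity_of_choose_modEq_zero_nat hn fun i hi => by
      rw [Finset.mem_Icc] at hi
      rw [Nat.modEq_zero_iff_dvd, ← CharP.cast_eq_zero_iff L p]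
      exact h i (by omega) (by omega)
  set k := multiplicity p n
  -- The unit group of `F` is cyclic of order `q - 1`, so `x ^ (n - 1) = 1` for all units `x` forces
  -- this divisibility.
  have hdvd : Fintype.card F - 1 ∣ n - 1 := by
    rw [← FiniteField.forall_pow_eq_one_iff F]
    intro x
    have h1 := hc x
    obtain ⟨m, rfl⟩ : ∃ m, n = m + 1 := ⟨n - 1, by omega⟩
    apply Units.ext
    rw [pow_succ] at h1
    simpa using mul_right_cancel₀ x.ne_zero (h1.trans (one_mul _).symm)
  -- With `q = p ^ e` and `n = p ^ k`, the gcd of `p ^ e - 1` and `p ^ k - 1` is `p ^ gcd(e, k) -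
  -- 1`, so the divisibility means `e ∣ k`.
  rw [he, hpow, ← Nat.gcd_eq_left_iff_dvd, Nat.pow_sub_one_gcd_pow_sub_one] at hdvd
  have hp1 := hpp.one_lt
  have h2 : p ^ Nat.gcd e k = p ^ (e : ℕ) := by
    have := Nat.one_le_pow (Nat.gcd e k) p hpp.pos
    have := Nat.one_le_pow (e : ℕ) p hpp.pos
    omega
  obtain ⟨m, hm⟩ := Nat.gcd_eq_left_iff_dvd.1 (Nat.pow_right_injective hp1 h2)
  exact ⟨m, by rw [hpow, he, ← pow_mul, hm]⟩

/-- The exponents of an additive polynomial compatible with the multiplication by the elements of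
`F` are powers of the cardinality of `F`. -/
theorem exists_eq_card_pow_of_additive {p : L[X]}
    (hadd : aeval (X + C X : L[X][X]) p = aeval (X : L[X][X]) p + aeval (C X : L[X][X]) p)
    (hsmul : ∀ c : F, aeval (c • X : L[X]) p = c • p) {n : ℕ} (hn : p.coeff n ≠ 0) :
    ∃ k, n = Fintype.card F ^ k := by
  have hC : aeval (C X : L[X][X]) p = C p := by
    have h := aeval_algHom_apply (IsScalarTower.toAlgHom L L[X] L[X][X]) X p
    rw [aeval_X_left_apply] at h
    exact h
  have hm (q : L[X][X]) : aeval q p = (p.map C).comp q := by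
    rw [comp, eval₂_map]; rfl
  -- Additivity at two independent variables, the outer `X` and the inner `C X`, is now an identity
  -- for a Taylor expansion, whose coefficients are Hasse derivatives.
  rw [hC, hm, hm, comp_X] at hadd
  have heval (q : L[X]) : (q.map C).eval X = q := by
    rw [Polynomial.eval_map, eval₂_C_X]
  have hpos : 0 < n := by
    refine Nat.pos_of_ne_zero ?_
    rintro rfl
    have h := congrArg (fun r : L[X][X] => (r.coeff 0).coeff 0) hadd
    simp only [← taylor_apply, taylor_coeff_zero, coeff_add, coeff_map, coeff_C_zero, heval] at h
    exact hn (by simpa using h)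
  refine exists_eq_card_pow (L := L) hpos (fun i hi hin => ?_) fun c => ?_
  · have hder : hasseDeriv i (p.map C) = (hasseDeriv i p).map C := by
      ext1 m
      simp [hasseDeriv_coeff]
    -- For `0 < i < n` this mixed coefficient is `n.choose i * p.coeff n` on the left and zero on
    -- the right.
    have h := congrArg (fun r : L[X][X] => (r.coeff i).coeff (n - i)) hadd
    simp only [← taylor_apply, taylor_coeff, coeff_add, coeff_map, coeff_C, hi.ne',
      if_false, add_zero, (Nat.sub_pos_of_lt hin).ne', hder, heval, hasseDeriv_coeff,
      Nat.sub_add_cancel hin.le] at h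
    exact (mul_eq_zero.1 h).resolve_right hn
  · have h := congrArg (fun r : L[X] => r.coeff n) (hsmul c)
    have h1 : aeval (c • X : L[X]) p = p.comp (C (algebraMap F L c) * X) := by
      rw [Algebra.smul_def]; rfl
    simp only [h1, comp_C_mul_X_coeff, coeff_smul] at h
    rw [mul_comm, Algebra.smul_def, ← map_pow] at h
    exact (algebraMap F L).injective (mul_right_cancel₀ hn h)

end AdditivePolynomial

/-! ### Points of `𝔾_a` and generation of its endomorphisms by scalars and Frobenius -/

namespace Ga

variable {F L : Type u} [Field F] [Field L] [Algebra F L]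

section onB

variable {B B' : Type u} [CommRing B] [Algebra L B] [Algebra F B] [IsScalarTower F L B]
  [CommRing B'] [Algebra L B'] [Algebra F B'] [IsScalarTower F L B']

theorem pointsEquiv_comp (f : B →ₐ[L] B') (x : specOver L B ⟶ (additive F L).toOver) :
    pointsEquiv B' (specOverMap f ≫ x) = f (pointsEquiv B x) := by
  change (Scheme.ΓSpecIso (CommRingCat.of B')).hom.hom
    ((Spec.map (CommRingCat.ofHom f.toRingHom)).appTop.hom (coord _ x)) = _
  exact congrArg (fun g => g.hom (coord _ x))
    (Scheme.ΓSpecIso_naturality (CommRingCat.ofHom f.toRingHom))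

theorem onB_map (g : additive F L ⟶ additive F L) (f : B →ₐ[L] B') (b : B) :
    onB g B' (f b) = f (onB g B b) := by
  obtain ⟨x, rfl⟩ := (pointsEquiv (F := F) (L := L) B).surjective b
  rw [← pointsEquiv_comp]
  simp only [onB, LinearMap.comp_apply, LinearEquiv.coe_coe, LinearEquiv.symm_apply_apply]
  rw [← pointsEquiv_comp]
  exact congrArg (pointsEquiv B') (Category.assoc (specOverMap f) x (VectScheme.hom g))

theorem onB_id : onB (𝟙 (additive F L)) B = LinearMap.id := by
  ext b
  change pointsEquiv B ((pointsEquiv B).symm b ≫ 𝟙 _) = b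
  rw [Category.comp_id, LinearEquiv.apply_symm_apply]

theorem onB_comp (g h : additive F L ⟶ additive F L) :
    onB (g ≫ h) B = onB h B ∘ₗ onB g B := by
  ext b
  change pointsEquiv B ((pointsEquiv B).symm b ≫ (VectScheme.hom g ≫ VectScheme.hom h)) =
    pointsEquiv B ((pointsEquiv B).symm (pointsEquiv B ((pointsEquiv B).symm b ≫
      VectScheme.hom g)) ≫ VectScheme.hom h)
  rw [LinearEquiv.symm_apply_apply, Category.assoc]

theorem onB_add (g h : additive F L ⟶ additive F L) : onB (g + h) B = onB g B + onB h B := by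
  ext b
  change pointsEquiv B ((pointsEquiv B).symm b ≫ (VectScheme.hom g + VectScheme.hom h)) = _
  rw [VectScheme.comp_add, map_add]
  rfl

theorem pointsEquiv_apply (x : specOver L B ⟶ (additive F L).toOver) :
    pointsEquiv B x = (Scheme.ΓSpecIso (CommRingCat.of B)).hom.hom (coord _ x) := rfl

theorem ΓSpecIso_structHom (l : L) :
    (Scheme.ΓSpecIso (CommRingCat.of B)).hom.hom (structHom (specOver L B) l) =
      algebraMap L B l := by
  have h : (Scheme.ΓSpecIso (CommRingCat.of L)).inv ≫
      (Spec.map (CommRingCat.ofHom (algebraMap L B))).appTop ≫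
        (Scheme.ΓSpecIso (CommRingCat.of B)).hom = CommRingCat.ofHom (algebraMap L B) := by
    rw [Scheme.ΓSpecIso_naturality, Iso.inv_hom_id_assoc]
  exact congrArg (fun f => f.hom l) h

theorem coord_comp_scalar (l : L) (T : Over (Spec (CommRingCat.of L)))
    (x : T ⟶ (additive F L).toOver) :
    coord (F := F) T (x ≫ VectScheme.hom (scalar l : additive F L ⟶ additive F L)) =
      structHom T l * coord (F := F) T x := by
  have hη {T T' : Over (Spec (CommRingCat.of L))} (g : T' ⟶ T) (s : Γ(T.left, ⊤)) :
      g.left.appTop.hom (structHom T l * s) = structHom T' l * g.left.appTop.hom s := by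
    rw [map_mul, appTop_structHom]
  exact coord_comp_ofNatural (fun T => letI := gammaAlgebra F L T
    LinearMap.mulLeft F (structHom T l)) hη T x

theorem coord_comp_frob [Fintype F] (T : Over (Spec (CommRingCat.of L)))
    (x : T ⟶ (additive F L).toOver) :
    coord (F := F) T (x ≫ VectScheme.hom (frob : additive F L ⟶ additive F L)) =
      coord (F := F) T x ^ Fintype.card F := by
  have hη {T T' : Over (Spec (CommRingCat.of L))} (g : T' ⟶ T) (s : Γ(T.left, ⊤)) :
      g.left.appTop.hom (s ^ Fintype.card F) = g.left.appTop.hom s ^ Fintype.card F :=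
    map_pow _ _ _
  exact coord_comp_ofNatural (fun T => letI := gammaAlgebra F L T
    (FiniteField.frobeniusAlgHom F Γ(T.left, ⊤)).toLinearMap) hη T x

theorem onB_pointsEquiv (g : additive F L ⟶ additive F L)
    (x : specOver L B ⟶ (additive F L).toOver) :
    onB g B (pointsEquiv B x) = pointsEquiv B (x ≫ VectScheme.hom g) := by
  simp only [onB, LinearMap.comp_apply, LinearEquiv.coe_coe, LinearEquiv.symm_apply_apply]
  rfl

theorem onB_scalar (l : L) (b : B) : onB (scalar l : additive F L ⟶ additive F L) B b = l • b := by
  obtain ⟨x, rfl⟩ := (pointsEquiv (F := F) (L := L) B).surjective b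
  rw [onB_pointsEquiv, pointsEquiv_apply, coord_comp_scalar, map_mul, ΓSpecIso_structHom,
    Algebra.smul_def, pointsEquiv_apply]

theorem onB_frob [Fintype F] :
    onB (frob : additive F L ⟶ additive F L) B = (FiniteField.frobeniusAlgHom F B).toLinearMap := by
  ext b
  obtain ⟨x, rfl⟩ := (pointsEquiv (F := F) (L := L) B).surjective b
  rw [onB_pointsEquiv, pointsEquiv_apply, coord_comp_frob, map_pow]
  rfl

end onB

/-- An endomorphism of `𝔾_a` is determined by its effect on points with values in `L`-algebras. -/
theorem ext_onB {g h : additive F L ⟶ additive F L}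
    (H : ∀ b, onB g (MvPolynomial PUnit.{u + 1} L) b = onB h _ b) : g = h := by
  -- The universal point: `𝔾_a` is the spectrum of a polynomial ring, and this isomorphism can be
  -- cancelled.
  let x : specOver L (MvPolynomial PUnit.{u + 1} L) ⟶ (additive F L).toOver :=
    Over.homMk (AffineSpace.SpecIso PUnit.{u + 1} (CommRingCat.of L)).inv
      (AffineSpace.SpecIso_inv_over (CommRingCat.of L))
  have : IsIso ((Over.forget _).map x) :=
    inferInstanceAs (IsIso (AffineSpace.SpecIso PUnit.{u + 1} (CommRingCat.of L)).inv)
  have : IsIso x := isIso_of_reflects_iso x (Over.forget _)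
  have h := H (pointsEquiv _ x)
  simp only [onB, LinearMap.comp_apply, LinearEquiv.coe_coe, LinearEquiv.symm_apply_apply] at h
  exact VectScheme.hom_ext ((cancel_epi x).1 ((pointsEquiv _).injective h))

/-- The point `b` is the specialisation of the generic point `X`, so by naturality one polynomial,
the image of `X`, describes `g` on all points. -/
theorem onB_eq_aeval (g : additive F L ⟶ additive F L) {B : Type u} [CommRing B] [Algebra L B]
    [Algebra F B] [IsScalarTower F L B] (b : B) :
    onB g B b = Polynomial.aeval b (onB g (Polynomial L) Polynomial.X) := by
  rw [← onB_map, Polynomial.aeval_X]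

/-- The endomorphisms of `𝔾_a` are the polynomials in the Frobenius with coefficients in `L`, on
the left. -/
theorem end_induction [Fintype F] {p : (additive F L ⟶ additive F L) → Prop}
    (id : p (𝟙 _)) (add : ∀ g h, p g → p h → p (g + h))
    (scalar : ∀ g (l : L), p g → p (g ≫ scalar l)) (frob : ∀ g, p g → p (g ≫ frob))
    (g : additive F L ⟶ additive F L) : p g := by
  set P := onB g (Polynomial L) Polynomial.X with hP
  have hpow (k : ℕ) : ∃ h, p h ∧ onB h (Polynomial L) Polynomial.X =
      (Polynomial.X : Polynomial L) ^ Fintype.card F ^ k := by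
    induction k with
    | zero => exact ⟨𝟙 _, id, by rw [onB_id]; simp⟩
    | succ k ih =>
      obtain ⟨h, hp, hh⟩ := ih
      refine ⟨h ≫ Ga.frob, frob h hp, ?_⟩
      rw [onB_comp, LinearMap.comp_apply, hh, onB_frob, pow_succ, pow_mul]
      rfl
  have hsupp (n : ℕ) (hn : n ∈ P.support) : ∃ k, n = Fintype.card F ^ k := by
    -- Linearity of `g` on points with values in `L[X][X]` and in `L[X]` gives the two hypotheses on
    -- `P`.
    refine exists_eq_card_pow_of_additive (F := F) (p := P) ?_ (fun c => ?_)
      (Polynomial.mem_support_iff.1 hn)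
    · simp only [hP, ← onB_eq_aeval, map_add]
    · simp only [hP, ← onB_eq_aeval, map_smul]
  have hsum (s : Finset ℕ) (hs : s ⊆ P.support) : ∃ h, p h ∧ onB h (Polynomial L) Polynomial.X =
      ∑ n ∈ s, P.coeff n • (Polynomial.X : Polynomial L) ^ n := by
    induction s using Finset.induction_on with
    | empty =>
      -- The zero endomorphism is reached from the identity by scaling with `0`.
      refine ⟨𝟙 _ ≫ Ga.scalar (0 : L), scalar _ _ id, ?_⟩
      rw [onB_comp, LinearMap.comp_apply, onB_scalar, zero_smul, Finset.sum_empty]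
    | insert n s hn ih =>
      obtain ⟨h, hp, hh⟩ := ih ((Finset.subset_insert n s).trans hs)
      obtain ⟨k, hk⟩ := hsupp n (hs (Finset.mem_insert_self n s))
      obtain ⟨h', hp', hh'⟩ := hpow k
      refine ⟨h' ≫ Ga.scalar (P.coeff n) + h, add _ _ (scalar _ _ hp') hp, ?_⟩
      rw [onB_add, LinearMap.add_apply, onB_comp, LinearMap.comp_apply, onB_scalar, hh, hh',
        Finset.sum_insert hn, hk]
  obtain ⟨h, hp, hh⟩ := hsum P.support subset_rfl
  have : onB g (Polynomial L) Polynomial.X = onB h (Polynomial L) Polynomial.X := by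
    rw [hh, ← hP]
    conv_lhs => rw [P.as_sum_support]
    simp only [Polynomial.smul_X_eq_monomial]
  rwa [ext_onB (g := g) (h := h) fun b => by rw [onB_eq_aeval, onB_eq_aeval h, this]]

end Ga

/-! ### Base change of the ring of functions to a field -/

section TensorDomain

theorem frobeniusAlgHom_injective (F B : Type u) [Field F] [Fintype F] [CommRing B] [IsReduced B]
    [Algebra F B] : Function.Injective (FiniteField.frobeniusAlgHom F B) := by
  rw [injective_iff_map_eq_zero]
  intro x hx
  exact eq_zero_of_pow_eq_zero (n := Fintype.card F) hx

/-- The tensor product of reduced algebras over a finite field is reduced. -/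
theorem isReduced_tensorProduct (F A B : Type u) [Field F] [Fintype F] [CommRing A] [Algebra F A]
    [CommRing B] [Algebra F B] [IsReduced A] [IsReduced B] : IsReduced (A ⊗[F] B) := by
  -- The `q`-power map on `A ⊗ B` is the tensor product of the two `q`-power maps; these are
  -- injective, and tensor products over a field preserve injectivity.
  have h : FiniteField.frobeniusAlgHom F (A ⊗[F] B) =
      Algebra.TensorProduct.map (FiniteField.frobeniusAlgHom F A)
        (FiniteField.frobeniusAlgHom F B) := by
    ext x
    · exact (Algebra.TensorProduct.tmul_pow x (1 : B) _).trans rfl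
    · exact (Algebra.TensorProduct.tmul_pow (1 : A) x _).trans rfl
  have hinj : Function.Injective (FiniteField.frobeniusAlgHom F (A ⊗[F] B)) := by
    rw [h]
    exact TensorProduct.map_injective_of_flat_flat _ _ (frobeniusAlgHom_injective F A)
      (frobeniusAlgHom_injective F B)
  refine (isReduced_iff_pow_one_lt (Fintype.card F) Fintype.one_lt_card).2 fun x hx => ?_
  exact hinj (hx.trans (map_zero _).symm)

/-- Restricting to an affine open inside `C ∖ {∞}` avoids any appeal to the affineness of `C ∖ {∞}`
itself: functions restrict injectively on an integral scheme. On the affine open, geometric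
irreducibility makes the nilradical of `B ⊗ k` prime, and reducedness makes it zero. -/
theorem PointedCurve.exists_affine_isDomain_tensorProduct {F : Type u} [Field F] [Fintype F]
    (C : PointedCurve F) :
    ∃ (B : Type u) (_ : CommRing B) (_ : Algebra F B) (f : C.A →ₐ[F] B), Function.Injective f ∧
      ∀ (k : Type u) [Field k] [Algebra F k], IsDomain (B ⊗[F] k) := by
  obtain ⟨x⟩ : Nonempty C.compl := inferInstance
  obtain ⟨V, hV, hxV, hVC⟩ := exists_isAffineOpen_mem_and_subset x.2
  have : Nonempty V := ⟨⟨x.1, hxV⟩⟩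
  have hVC' : V ≤ C.compl := hVC
  let B := Γ(C.X, V)
  let g : CommRingCat.of F ⟶ B := (Scheme.ΓSpecIso (CommRingCat.of F)).inv ≫
    C.str.appLE ⊤ V le_top
  algebraize [g.hom]
  refine ⟨B, inferInstance, inferInstance, ⟨(C.X.presheaf.map (homOfLE hVC').op).hom, ?_⟩, ?_, ?_⟩
  · intro c
    have h : ((Scheme.ΓSpecIso (CommRingCat.of F)).inv ≫ C.str.appLE ⊤ C.compl le_top) ≫
        C.X.presheaf.map (homOfLE hVC').op = g :=
      (Category.assoc _ _ _).trans (congrArg ((Scheme.ΓSpecIso (CommRingCat.of F)).inv ≫ ·)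
        (C.str.appLE_map le_top (homOfLE hVC').op))
    exact congrArg (fun e => e.hom c) h
  · exact map_injective_of_isIntegral C.X (homOfLE hVC')
  · intro k _ _
    have : IsReduced (B ⊗[F] k) := isReduced_tensorProduct F B k
    have hg : hV.fromSpec ≫ C.str = Spec.map (CommRingCat.ofHom (algebraMap F B)) := by
      rw [← IsAffineOpen.SpecMap_appLE_fromSpec C.str (isAffineOpen_top _) hV le_top,
        IsAffineOpen.fromSpec_top, Scheme.isoSpec_Spec_inv, ← Spec.map_comp]
      rfl
    have : Subsingleton (Spec (CommRingCat.of F)) :=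
      inferInstanceAs (Subsingleton (PrimeSpectrum F))
    have : Nonempty (Spec B) := inferInstanceAs (Nonempty (PrimeSpectrum B))
    -- Geometric irreducibility passes to a nonempty open subscheme; nonemptiness enters as
    -- surjectivity onto the one-point base.
    have : Surjective (hV.fromSpec ≫ C.str) :=
      ⟨fun y => ⟨Classical.arbitrary (Spec B), Subsingleton.elim _ _⟩⟩
    have h1 : GeometricallyIrreducible (hV.fromSpec ≫ C.str) := inferInstance
    have h2 := pullback_of_geometrically h1.geometrically_irreducibleSpace k
      (Spec.map (CommRingCat.ofHom (algebraMap F k)))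
    rw [hg] at h2
    have h3 : IrreducibleSpace (PrimeSpectrum (B ⊗[F] k)) :=
      (pullbackSpecIso F B k).hom.homeomorph.irreducibleSpace_iff.1 h2
    rw [PrimeSpectrum.irreducibleSpace_iff_isPrime_nilradical, nilradical_eq_zero] at h3
    exact @IsDomain.of_bot_isPrime (B ⊗[F] k) _ h3

theorem PointedCurve.isDomain_tensorProduct {F : Type u} [Field F] [Fintype F]
    (C : PointedCurve F) (k : Type u) [Field k]
    [Algebra F k] : IsDomain (C.A ⊗[F] k) := by
  obtain ⟨B, _, _, f, hf, h⟩ := C.exists_affine_isDomain_tensorProduct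
  have := h k
  exact Function.Injective.isDomain (Algebra.TensorProduct.map f (AlgHom.id F k)).toRingHom
    (Module.Flat.rTensor_preserves_injective_linearMap f.toLinearMap hf)

end TensorDomain

/-! ### The general Tate algebra is torsion-free over `A ⊗ L` -/

section ResidueField

variable (F V : Type u) [Field F] [Fintype F] [NormedField V] [IsUltrametricDist V] [Algebra F V]

/-- The ring of elements of norm at most one, as an algebra over the finite field `F`. -/
def unitBall : Subalgebra F V where
  carrier := {v | ‖v‖ ≤ 1}
  mul_mem' {v w} hv hw := by
    rw [Set.mem_ofPred_eq, norm_mul]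
    exact mul_le_one₀ hv (norm_nonneg w) hw
  add_mem' {v w} hv hw := (IsUltrametricDist.norm_add_le_max v w).trans (max_le hv hw)
  algebraMap_mem' c := by
    rw [Set.mem_ofPred_eq]
    by_cases hc : c = 0
    · rw [hc, map_zero, norm_zero]
      exact zero_le_one
    -- Nonzero constants are roots of unity, hence of norm one.
    · have h : algebraMap F V c ^ (Fintype.card F - 1) = 1 := by
        rw [← map_pow, FiniteField.pow_card_sub_one_eq_one c hc, map_one]
      have h1 : 1 < Fintype.card F := Fintype.one_lt_card
      exact ((pow_eq_one_iff_of_nonneg (norm_nonneg _)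
        (Nat.sub_ne_zero_of_lt h1)).1
        (by rw [← norm_pow, h, norm_one])).le

/-- The ideal of elements of norm less than one. -/
def openUnitBall : Ideal (unitBall F V) where
  carrier := {v | ‖(v : V)‖ < 1}
  zero_mem' := by simp
  add_mem' {v w} hv hw := (IsUltrametricDist.norm_add_le_max (v : V) w).trans_lt (max_lt hv hw)
  smul_mem' c v hv := by
    change ‖(c : V) * v‖ < 1
    rw [norm_mul]
    exact mul_lt_one_of_nonneg_of_lt_one_right c.2 (norm_nonneg _) hv

theorem mem_openUnitBall {v : unitBall F V} : v ∈ openUnitBall F V ↔ ‖(v : V)‖ < 1 := Iff.rfl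

/-- An integral element outside this ideal has norm exactly one, so its inverse is integral too. -/
instance : (openUnitBall F V).IsMaximal := by
  rw [Ideal.isMaximal_iff]
  refine ⟨by simp [mem_openUnitBall], fun J x hJ hx hxJ => ?_⟩
  have h1 : ‖(x : V)‖ = 1 := le_antisymm x.2 (not_lt.1 hx)
  have h0 : (x : V) ≠ 0 := norm_ne_zero_iff.1 (by rw [h1]; exact one_ne_zero)
  let y : unitBall F V := ⟨(x : V)⁻¹, show ‖(x : V)⁻¹‖ ≤ 1 by rw [norm_inv, h1, inv_one]⟩
  have : y * x = 1 := Subtype.ext (inv_mul_cancel₀ h0)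
  rw [← this]
  exact J.mul_mem_left y hxJ

/-- The residue field of `V`. -/
def ResidueField : Type u := unitBall F V ⧸ openUnitBall F V

instance : Field (ResidueField F V) := Ideal.Quotient.field (openUnitBall F V)

instance : Algebra F (ResidueField F V) :=
  inferInstanceAs (Algebra F (unitBall F V ⧸ openUnitBall F V))

/-- The reduction map to the residue field. -/
def toResidueField : unitBall F V →ₐ[F] ResidueField F V :=
  Ideal.Quotient.mkₐ F (openUnitBall F V)

variable {F V} in
theorem toResidueField_eq_zero {v : unitBall F V} (hv : ‖(v : V)‖ < 1) :
    toResidueField F V v = 0 :=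
  Ideal.Quotient.eq_zero_iff_mem.2 hv

end ResidueField

/-! ### Multiplicativity of the Gauss norm -/

namespace PreTate

section Norm

variable {F A V : Type u} [Field F] [CommRing A] [Algebra F A] [NormedField V] [Algebra F V]

theorem norm_tmul_le (a : A) (v : V) : ‖(tmul a v : PreTate F A V)‖ ≤ ‖v‖ :=
  gaussNorm_le (norm_nonneg v) (AddSubmonoid.subset_closure ⟨a, v, le_rfl, rfl⟩)

theorem norm_one_tmul_mul (v : V) (x : PreTate F A V) : ‖tmul 1 v * x‖ = ‖v‖ * ‖x‖ := by
  have hle (v : V) (x : PreTate F A V) : ‖tmul 1 v * x‖ ≤ ‖v‖ * ‖x‖ :=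
    (norm_mul_le _ _).trans (mul_le_mul_of_nonneg_right (norm_tmul_le 1 v) (norm_nonneg x))
  refine (hle v x).antisymm ?_
  rcases eq_or_ne v 0 with rfl | hv
  · rw [norm_zero, zero_mul]
    exact norm_nonneg _
  -- The reverse inequality is the easy one applied to `v⁻¹`.
  have h : tmul 1 v⁻¹ * (tmul 1 v * x) = x := by
    rw [← mul_assoc, tmul_mul_tmul, one_mul, inv_mul_cancel₀ hv]
    exact one_mul x
  calc ‖v‖ * ‖x‖ = ‖v‖ * ‖tmul 1 v⁻¹ * (tmul 1 v * x)‖ := by rw [h]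
    _ ≤ ‖v‖ * (‖v⁻¹‖ * ‖tmul 1 v * x‖) := mul_le_mul_of_nonneg_left (hle _ _) (norm_nonneg v)
    _ = ‖tmul 1 v * x‖ := by
      rw [← mul_assoc, norm_inv, mul_inv_cancel₀ (norm_ne_zero_iff.2 hv), one_mul]

end Norm

variable (F A V : Type u) [Field F] [Fintype F] [CommRing A] [Algebra F A] [NormedField V]
  [IsUltrametricDist V] [Algebra F V]

/-- The inclusion of the tensors with integral coefficients. -/
def ofUnitBall : A ⊗[F] unitBall F V →+* PreTate F A V :=
  (Algebra.TensorProduct.map (AlgHom.id F A) (unitBall F V).val).toRingHom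

/-- The reduction of tensors with integral coefficients. -/
def residue : A ⊗[F] unitBall F V →ₐ[F] A ⊗[F] ResidueField F V :=
  Algebra.TensorProduct.map (AlgHom.id F A) (toResidueField F V)

variable {F A V}

theorem ofUnitBall_injective : Function.Injective (ofUnitBall F A V) :=
  Module.Flat.lTensor_preserves_injective_linearMap (unitBall F V).val.toLinearMap
    Subtype.val_injective

/-- Some representation of `y` has all its coefficients in the open unit ball, and each of its terms
reduces to zero. -/
theorem exists_of_norm_lt_one {y : PreTate F A V} (hy : ‖y‖ < 1) :
    ∃ z, ofUnitBall F A V z = y ∧ residue F A V z = 0 := by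
  obtain ⟨r, hr, hr1⟩ := exists_between hy
  have h := mem_level_of_gaussNorm_lt hr
  clear hy hr
  induction h using AddSubmonoid.closure_induction with
  | mem x hx =>
    obtain ⟨a, v, hv, rfl⟩ := hx
    have hv1 := hv.trans_lt hr1
    refine ⟨a ⊗ₜ ⟨v, hv1.le⟩, Algebra.TensorProduct.map_tmul _ _ _ _, ?_⟩
    refine (Algebra.TensorProduct.map_tmul _ _ _ _).trans ?_
    rw [toResidueField_eq_zero hv1, TensorProduct.tmul_zero]
  | zero => exact ⟨0, map_zero _, map_zero _⟩
  | add x y _ _ hx hy =>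
    obtain ⟨z, rfl, hz⟩ := hx
    obtain ⟨w, rfl, hw⟩ := hy
    exact ⟨z + w, map_add _ _ _, by rw [map_add, hz, hw, add_zero]⟩

theorem norm_ofUnitBall {z : A ⊗[F] unitBall F V} (hz : residue F A V z ≠ 0) :
    ‖ofUnitBall F A V z‖ = 1 := by
  refine le_antisymm (gaussNorm_le zero_le_one ?_) (not_lt.1 fun h => hz ?_)
  · clear hz
    induction z using TensorProduct.induction_on with
    | zero => rw [map_zero]; exact zero_mem _
    | tmul a v =>
      exact AddSubmonoid.subset_closure ⟨a, v, v.2, Algebra.TensorProduct.map_tmul _ _ _ _⟩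
    | add x y hx hy => rw [map_add]; exact add_mem hx hy
  · obtain ⟨w, hw, hw0⟩ := exists_of_norm_lt_one h
    rwa [← ofUnitBall_injective hw]

/-- Normalisation as in Gauss's lemma: expand `x` in an `F`-basis of `A` and factor out a
coefficient of maximal norm. The quotient is integral with one coefficient equal to `1`, so its
reduction is nonzero. -/
theorem exists_eq_tmul_mul {x : PreTate F A V} (hx : x ≠ 0) :
    ∃ (v : V) (z : A ⊗[F] unitBall F V), v ≠ 0 ∧ residue F A V z ≠ 0 ∧
      x = tmul 1 v * ofUnitBall F A V z := by
  classical
  let b := Module.Basis.ofVectorSpace F A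
  obtain ⟨φ, rfl⟩ := (TensorProduct.equivFinsuppOfBasisLeft (N := V) b).symm.surjective x
  have hφ : φ.support.Nonempty := by
    rw [Finsupp.support_nonempty_iff]
    rintro rfl
    exact hx (map_zero _)
  obtain ⟨i, hi, hmax⟩ := φ.support.exists_max_image (fun i => ‖φ i‖) hφ
  have hi0 : φ i ≠ 0 := Finsupp.mem_support_iff.1 hi
  have hle (j) : ‖φ j / φ i‖ ≤ 1 := by
    rw [norm_div]
    refine div_le_one_of_le₀ ?_ (norm_nonneg _)
    by_cases hj : j ∈ φ.support
    · exact hmax j hj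
    · rw [Finsupp.notMem_support_iff.1 hj, norm_zero]
      exact norm_nonneg _
  let ψ (j) : unitBall F V := ⟨φ j / φ i, hle j⟩
  refine ⟨φ i, ∑ j ∈ φ.support, b j ⊗ₜ ψ j, hi0, fun h => ?_, ?_⟩
  · rw [map_sum] at h
    have h' : ∑ j ∈ φ.support, b j ⊗ₜ[F] (toResidueField F V (ψ j)) = 0 := h
    have h1 : ψ i = 1 := Subtype.ext (div_self hi0)
    have h2 := congrArg (fun y => TensorProduct.equivFinsuppOfBasisLeft b y i) h'
    simp only [map_sum, Finsupp.finsetSum_apply,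
      TensorProduct.equivFinsuppOfBasisLeft_apply_tmul_apply, Module.Basis.repr_self,
      Finsupp.single_apply, ite_smul, one_smul, zero_smul, Finset.sum_ite_eq', hi, if_true, h1,
      map_zero, Finsupp.zero_apply, map_one] at h2
    exact one_ne_zero h2
  · rw [TensorProduct.equivFinsuppOfBasisLeft_symm_apply, map_sum, Finset.mul_sum]
    refine Finset.sum_congr rfl fun j _ => ?_
    refine Eq.trans ?_ (tmul_mul_tmul 1 (b j) (φ i) (φ j / φ i)).symm
    rw [one_mul, mul_div_cancel₀ _ hi0]
    rfl

theorem norm_eq_norm_tmul {v : V} {z : A ⊗[F] unitBall F V} (hz : residue F A V z ≠ 0) :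
    ‖tmul 1 v * ofUnitBall F A V z‖ = ‖v‖ := by
  rw [norm_one_tmul_mul, norm_ofUnitBall hz, mul_one]

theorem norm_ne_zero {x : PreTate F A V} (hx : x ≠ 0) : ‖x‖ ≠ 0 := by
  obtain ⟨v, z, hv, hz, rfl⟩ := exists_eq_tmul_mul hx
  rw [norm_eq_norm_tmul hz]
  exact norm_ne_zero_iff.2 hv

/-- Over a geometrically integral `A`, the Gauss norm is multiplicative. -/
theorem norm_mul_eq [IsDomain (A ⊗[F] ResidueField F V)] (x y : PreTate F A V) :
    ‖x * y‖ = ‖x‖ * ‖y‖ := by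
  rcases eq_or_ne x 0 with rfl | hx
  · rw [zero_mul, norm_zero, zero_mul]
  rcases eq_or_ne y 0 with rfl | hy
  · rw [mul_zero, norm_zero, mul_zero]
  obtain ⟨v, z, hv, hz, rfl⟩ := exists_eq_tmul_mul hx
  obtain ⟨w, z', hw, hz', rfl⟩ := exists_eq_tmul_mul hy
  -- The product of the two primitive parts is again primitive, because the reductions are nonzero
  -- in a domain.
  rw [mul_mul_mul_comm, tmul_mul_tmul, one_mul, ← map_mul, norm_eq_norm_tmul hz,
    norm_eq_norm_tmul hz', norm_eq_norm_tmul (by rw [map_mul]; exact mul_ne_zero hz hz'), norm_mul]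

end PreTate

namespace Tate

section TorsionFree

variable {F A V : Type u} [Field F] [Fintype F] [CommRing A] [Algebra F A] [NormedField V]
  [IsUltrametricDist V] [Algebra F V] [IsDomain (A ⊗[F] ResidueField F V)]

theorem norm_of_mul (x : PreTate F A V) (ω : Tate F A V) : ‖of x * ω‖ = ‖x‖ * ‖ω‖ := by
  induction ω using UniformSpace.Completion.induction_on with
  | hp => exact isClosed_eq (by fun_prop) (by fun_prop)
  | ih y =>
    change ‖(x : Tate F A V) * (y : Tate F A V)‖ = _
    rw [← UniformSpace.Completion.coe_mul, UniformSpace.Completion.norm_coe,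
      UniformSpace.Completion.norm_coe, PreTate.norm_mul_eq]

/-- The nonzero elements of `A ⊗ L` are nonzerodivisors on the general Tate algebra. -/
theorem eq_zero_of_smul_eq_zero {L : Type u} [Field L] [Algebra F L] [Algebra L V]
    [IsScalarTower F L V] {r : A ⊗[F] L} (hr : r ≠ 0) {ω : Tate F A V} (h : r • ω = 0) :
    ω = 0 := by
  have hinj : Function.Injective (Algebra.TensorProduct.map (AlgHom.id F A)
      (IsScalarTower.toAlgHom F L V)) :=
    Module.Flat.lTensor_preserves_injective_linearMap (IsScalarTower.toAlgHom F L V).toLinearMap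
      (algebraMap L V).injective
  have hx : Algebra.TensorProduct.map (AlgHom.id F A) (IsScalarTower.toAlgHom F L V) r ≠ 0 :=
    fun h => hr (hinj (h.trans (map_zero _).symm))
  have h1 := norm_of_mul (F := F) (A := A) (V := V)
    (Algebra.TensorProduct.map (AlgHom.id F A) (IsScalarTower.toAlgHom F L V) r) ω
  have h2 : ‖r • ω‖ = _ := h1
  rw [h, norm_zero, eq_comm, mul_eq_zero] at h2
  exact norm_eq_zero.1 (h2.resolve_left (PreTate.norm_ne_zero hx))

end TorsionFree

end Tate

/-! ### Functoriality of the general Tate algebra -/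

/-- The Frobenius twist `a ⊗ v ↦ a ⊗ v ^ q` on `A ⊗ B`. -/
def tensorTwist (F A B : Type u) [Field F] [Fintype F] [CommRing A] [Algebra F A] [CommRing B]
    [Algebra F B] : A ⊗[F] B →ₐ[F] A ⊗[F] B :=
  Algebra.TensorProduct.map (AlgHom.id F A) (FiniteField.frobeniusAlgHom F B)

theorem tensorTwist_injective (F A L : Type u) [Field F] [Fintype F] [CommRing A] [Algebra F A]
    [Field L] [Algebra F L] : Function.Injective (tensorTwist F A L) :=
  Module.Flat.lTensor_preserves_injective_linearMap
    (FiniteField.frobeniusAlgHom F L).toLinearMap (FiniteField.frobeniusAlgHom F L).injective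

namespace PreTate

variable {F A V : Type u} [Field F] [CommRing A] [Algebra F A] [NormedField V] [Algebra F V]

theorem map_add (g : V →ₗ[F] V) (x y : PreTate F A V) : map g (x + y) = map g x + map g y :=
  _root_.map_add (LinearMap.lTensor A g) x y

theorem map_tmul (g : V →ₗ[F] V) (a : A) (v : V) :
    (map g (tmul a v) : PreTate F A V) = tmul a (g v) := rfl

theorem induction {p : PreTate F A V → Prop} (tmul : ∀ a v, p (tmul a v))
    (add : ∀ x y, p x → p y → p (x + y)) (x : PreTate F A V) : p x := by
  refine TensorProduct.induction_on (motive := p) x ?_ tmul add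
  exact TensorProduct.zero_tmul (R := F) A (0 : V) ▸ tmul 0 0

end PreTate

namespace Tate

variable {F A V : Type u} [Field F] [CommRing A] [Algebra F A] [NormedField V] [Algebra F V]

open UniformSpace (Completion)

theorem continuous_map (g : V →ₗ[F] V) : Continuous (map g : Tate F A V → Tate F A V) :=
  Completion.continuous_map

theorem map_coe {g : V →ₗ[F] V} (hg : Continuous g) (x : PreTate F A V) :
    (map g (x : Tate F A V) : Tate F A V) = (PreTate.map g x : PreTate F A V) :=
  Completion.map_coe (PreTate.uniformContinuous_map g hg) x

theorem map_id (ω : Tate F A V) : map LinearMap.id ω = ω := by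
  induction ω using Completion.induction_on with
  | hp => exact isClosed_eq (continuous_map _) continuous_id
  | ih x =>
    rw [map_coe continuous_id]
    exact congrArg _ (LinearMap.lTensor_id_apply A V x)

theorem map_comp {g h : V →ₗ[F] V} (hg : Continuous g) (hh : Continuous h) (ω : Tate F A V) :
    map (h ∘ₗ g) ω = map h (map g ω) := by
  induction ω using Completion.induction_on with
  | hp => exact isClosed_eq (continuous_map _) ((continuous_map _).comp (continuous_map _))
  | ih x =>
    rw [map_coe (g := h ∘ₗ g) (hh.comp hg), map_coe hg, map_coe hh]
    exact congrArg _ (LinearMap.lTensor_comp_apply A h g x)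

theorem add_map {g h : V →ₗ[F] V} (hg : Continuous g) (hh : Continuous h) (ω : Tate F A V) :
    map (g + h) ω = map g ω + map h ω := by
  have hc : Continuous (map g : Tate F A V → Tate F A V) := continuous_map g
  have hc' : Continuous (map h : Tate F A V → Tate F A V) := continuous_map h
  induction ω using Completion.induction_on with
  | hp => exact isClosed_eq (continuous_map _) (by fun_prop)
  | ih x =>
    rw [map_coe (hg.add hh), map_coe hg, map_coe hh, ← Completion.coe_add]
    exact congrArg _ (congrArg (fun f => f x) (LinearMap.lTensor_add A g h))

theorem map_mulLeft (v : V) (ω : Tate F A V) :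
    map (LinearMap.mulLeft F v) ω = of ((1 : A) ⊗ₜ v) * ω := by
  induction ω using Completion.induction_on with
  | hp => exact isClosed_eq (continuous_map _) (by fun_prop)
  | ih x =>
    rw [map_coe (continuous_const_mul v)]
    change _ = ((PreTate.tmul 1 v : PreTate F A V) : Tate F A V) * x
    rw [← Completion.coe_mul]
    congr 1
    induction x using PreTate.induction with
    | tmul a w =>
      rw [PreTate.tmul_mul_tmul, one_mul]
      rfl
    | add x y hx hy => rw [PreTate.map_add, hx, hy, mul_add]

theorem map_of_mul {g : V →ₗ[F] V} (hg : Continuous g) (a : A) (ω : Tate F A V) :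
    map g (of (a ⊗ₜ 1) * ω) = of (a ⊗ₜ 1) * map g ω := by
  have hc : Continuous (map g : Tate F A V → Tate F A V) := continuous_map g
  induction ω using Completion.induction_on with
  | hp => exact isClosed_eq (by fun_prop) (by fun_prop)
  | ih x =>
    change map g (((PreTate.tmul a 1 : PreTate F A V) : Tate F A V) * (x : Tate F A V)) =
      ((PreTate.tmul a 1 : PreTate F A V) : Tate F A V) * _
    rw [← Completion.coe_mul, map_coe hg, map_coe hg, ← Completion.coe_mul]
    congr 1
    induction x using PreTate.induction with
    | tmul b w =>
      rw [PreTate.map_tmul, PreTate.tmul_mul_tmul, PreTate.tmul_mul_tmul, one_mul, one_mul]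
      rfl
    | add x y hx hy => rw [mul_add, PreTate.map_add, hx, hy, ← mul_add, PreTate.map_add]

theorem continuous_frobenius [Fintype F] :
    Continuous (FiniteField.frobeniusAlgHom F V).toLinearMap :=
  continuous_pow (Fintype.card F)

theorem twist_of_mul [Fintype F] (x : A ⊗[F] V) (ω : Tate F A V) :
    twist (of x * ω) = of (tensorTwist F A V x) * twist ω := by
  have hc : Continuous (twist : Tate F A V → Tate F A V) := continuous_map _
  induction ω using Completion.induction_on with
  | hp => exact isClosed_eq (by fun_prop) (by fun_prop)
  | ih y =>
    let x' : PreTate F A V := x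
    let z : PreTate F A V := tensorTwist F A V x
    change map _ ((x' : Tate F A V) * (y : Tate F A V)) = (z : Tate F A V) * map _ _
    rw [← Completion.coe_mul, map_coe continuous_frobenius, map_coe continuous_frobenius,
      ← Completion.coe_mul]
    congr 1
    exact _root_.map_mul (tensorTwist F A V) x y

section SMul

variable {L : Type u} [Field L] [Algebra F L] [Algebra L V] [IsScalarTower F L V]

theorem smul_def (r : A ⊗[F] L) (ω : Tate F A V) :
    r • ω = of (Algebra.TensorProduct.map (AlgHom.id F A) (IsScalarTower.toAlgHom F L V) r) * ω :=
  rfl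

theorem tmul_one_smul (a : A) (ω : Tate F A V) : (a ⊗ₜ[F] (1 : L)) • ω = of (a ⊗ₜ 1) * ω := by
  rw [smul_def, Algebra.TensorProduct.map_tmul, map_one]
  rfl

theorem twist_smul [Fintype F] (r : A ⊗[F] L) (ω : Tate F A V) :
    twist (r • ω) = tensorTwist F A L r • twist ω := by
  rw [smul_def, twist_of_mul, smul_def]
  congr 2
  induction r using TensorProduct.induction_on with
  | zero => simp only [map_zero]
  | tmul a l =>
    refine congrArg (a ⊗ₜ[F] ·) ?_
    exact (map_pow (algebraMap L V) l _).symm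
  | add x y hx hy => simp only [_root_.map_add, hx, hy]

end SMul

end Tate

/-! ### The action of the endomorphisms of `𝔾_a` on the general Tate algebra -/

namespace Ga

variable {F L V : Type u} [Field F] [Field L] [Algebra F L]
  [NormedField V] [Algebra F V] [Algebra L V] [IsScalarTower F L V]

theorem onB_scalar_eq_mulLeft (l : L) :
    onB (scalar l : additive F L ⟶ additive F L) V = LinearMap.mulLeft F (algebraMap L V l) := by
  ext v
  rw [onB_scalar, Algebra.smul_def, LinearMap.mulLeft_apply]

theorem continuous_onB [Fintype F] (g : additive F L ⟶ additive F L) : Continuous (onB g V) := by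
  induction g using end_induction with
  | id => rw [onB_id]; exact continuous_id
  | add g h hg hh => rw [onB_add]; exact hg.add hh
  | scalar g l hg =>
    rw [onB_comp, onB_scalar_eq_mulLeft]
    exact (continuous_const_mul _).comp hg
  | frob g hg =>
    rw [onB_comp, onB_frob]
    exact Tate.continuous_frobenius.comp hg

end Ga

/-! ### The field `ℂ_∞` -/

instance PointedCurve.Place.isUltrametricDist {F : Type u} [Field F] {C : PointedCurve F}
    (P : C.Place) : IsUltrametricDist P.Cinf := by
  refine IsUltrametricDist.isUltrametricDist_of_forall_norm_add_le_max_norm fun x y => ?_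
  induction x, y using UniformSpace.Completion.induction_on₂ with
  | hp => exact isClosed_le (by fun_prop) (by fun_prop)
  | ih x y =>
    rw [← UniformSpace.Completion.coe_add]
    simp only [UniformSpace.Completion.norm_coe]
    exact P.isNonarchimedean _ _

/-! ### Equations over the fraction field -/

section FractionRing

variable {R M : Type u} [CommRing R] [IsDomain R] [AddCommGroup M] [Module R M]

/-- An equation `y = f · x` in the base change of a module to the fraction field is an equation
`d y = g x` in the module. -/
theorem one_tmul_eq_smul_iff {f : FractionRing R} {x y : M} :
    ((1 : FractionRing R) ⊗ₜ[R] y : FractionRing R ⊗[R] M) = f • ((1 : FractionRing R) ⊗ₜ[R] x) ↔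
      ∃ d g : R, d ≠ 0 ∧ algebraMap R (FractionRing R) d * f = algebraMap R (FractionRing R) g ∧
        d • y = g • x := by
  have hd {d g : R} (hd : d ≠ 0)
      (h : algebraMap R (FractionRing R) d * f = algebraMap R (FractionRing R) g) :
      ((1 : FractionRing R) ⊗ₜ[R] y : FractionRing R ⊗[R] M) = f • ((1 : FractionRing R) ⊗ₜ[R] x) ↔
        ((1 : FractionRing R) ⊗ₜ[R] (d • y) : FractionRing R ⊗[R] M) =
          (1 : FractionRing R) ⊗ₜ[R] (g • x) := by
    have hd' : algebraMap R (FractionRing R) d ≠ 0 :=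
      (map_ne_zero_iff _ (IsFractionRing.injective R (FractionRing R))).2 hd
    rw [TensorProduct.tmul_smul, TensorProduct.tmul_smul, ← algebraMap_smul (FractionRing R) d,
      ← algebraMap_smul (FractionRing R) g, ← h, mul_smul, smul_right_inj hd']
  constructor
  · intro h
    obtain ⟨g, ⟨d, hdm⟩, hf⟩ := IsLocalization.exists_mk'_eq (nonZeroDivisors R) f
    have hd0 : d ≠ 0 := nonZeroDivisors.ne_zero hdm
    have hdf : algebraMap R (FractionRing R) d * f = algebraMap R (FractionRing R) g := by
      rw [← hf]
      exact IsLocalization.mk'_spec' (FractionRing R) g ⟨d, hdm⟩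
    rw [hd hd0 hdf] at h
    -- `M` may have torsion, so after clearing the denominator of `f` the equation descends only up
    -- to a further factor `s`, absorbed into both `d` and `g`.
    obtain ⟨s, hs⟩ := (IsLocalizedModule.eq_iff_exists (nonZeroDivisors R)
      (TensorProduct.mk R (FractionRing R) M 1)).1 h
    refine ⟨s * d, s * g, mul_ne_zero (nonZeroDivisors.ne_zero s.2) hd0, ?_, ?_⟩
    · rw [map_mul, map_mul, mul_assoc, hdf]
    · rw [mul_smul, mul_smul]
      exact hs
  · rintro ⟨d, g, hd0, hf, h⟩
    rw [hd hd0 hf, h]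

/-- If the rank of `M` is at most one and `x` is not a torsion element, then every element of `M`
is a unique multiple of `x` over the fraction field. -/
theorem existsUnique_one_tmul_eq_smul [Module.Finite R M] (hM : Module.finrank R M ≤ 1) {x : M}
    (hx : ∀ r : R, r • x = 0 → r = 0) (y : M) :
    ∃! f : FractionRing R, ((1 : FractionRing R) ⊗ₜ[R] y : FractionRing R ⊗[R] M) =
      f • ((1 : FractionRing R) ⊗ₜ[R] x) := by
  have hinj := IsFractionRing.injective R (FractionRing R)
  -- Rank at most one gives a relation `g x + d y = 0`; since `x` is not torsion, `d ≠ 0` and `f =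
  -- -g / d`.
  have hlin : ¬ LinearIndependent R ![x, y] := fun h => by
    have := h.fintype_card_le_finrank
    simp at this
    omega
  simp only [LinearIndependent.pair_iff, not_forall] at hlin
  obtain ⟨g, d, h, hgd⟩ := hlin
  have hd : d ≠ 0 := by
    rintro rfl
    rw [zero_smul, add_zero] at h
    exact hgd ⟨hx g h, rfl⟩
  have hd' : algebraMap R (FractionRing R) d ≠ 0 := (map_ne_zero_iff _ hinj).2 hd
  refine ⟨algebraMap R _ (-g) / algebraMap R _ d, ?_, fun f hf => ?_⟩
  · refine one_tmul_eq_smul_iff.2 ⟨d, -g, hd, mul_div_cancel₀ _ hd', ?_⟩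
    rw [neg_smul]
    exact eq_neg_of_add_eq_zero_right h
  · obtain ⟨d', g', hd0, hf, h'⟩ := one_tmul_eq_smul_iff.1 hf
    have hd0' : algebraMap R (FractionRing R) d' ≠ 0 := (map_ne_zero_iff _ hinj).2 hd0
    have hgg : d * g' = d' * -g := by
      rw [← sub_eq_zero]
      apply hx
      rw [sub_smul, mul_smul, mul_smul, ← h', smul_comm d d' y, ← smul_sub, neg_smul,
        sub_neg_eq_add, add_comm, h, smul_zero]
    rw [eq_div_iff hd']
    apply mul_left_cancel₀ hd0'
    rw [← mul_assoc, hf, ← map_mul, ← map_mul, mul_comm, hgg]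

/-- The set of `z : M` for which some nonzero multiple lies in the span of `x` is a submodule. -/
def saturatedSpan (x : M) : Submodule R M where
  carrier := {z | ∃ d g : R, d ≠ 0 ∧ d • z = g • x}
  zero_mem' := ⟨1, 0, one_ne_zero, by rw [smul_zero, zero_smul]⟩
  add_mem' := by
    rintro z w ⟨d, g, hd, h⟩ ⟨d', g', hd', h'⟩
    refine ⟨d' * d, d' * g + d * g', mul_ne_zero hd' hd, ?_⟩
    rw [smul_add, mul_smul, h, mul_comm d', mul_smul, h', add_smul, mul_smul, mul_smul]
  smul_mem' := by
    rintro r z ⟨d, g, hd, h⟩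
    exact ⟨d, r * g, hd, by rw [smul_comm, h, mul_smul]⟩

theorem self_mem_saturatedSpan (x : M) : x ∈ saturatedSpan (R := R) x :=
  ⟨1, 1, one_ne_zero, rfl⟩

/-- The saturated span of `x` is stable under a semilinear map `τ` if it contains `τ x`. -/
theorem map_mem_saturatedSpan {σ : R → R} (hσ : ∀ r, r ≠ 0 → σ r ≠ 0) {τ : M → M}
    (hτ : ∀ r m, τ (r • m) = σ r • τ m) {x : M} (hx : τ x ∈ saturatedSpan (R := R) x) {z : M}
    (hz : z ∈ saturatedSpan (R := R) x) : τ z ∈ saturatedSpan (R := R) x := by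
  obtain ⟨d, g, hd, h⟩ := hz
  obtain ⟨d', g', hd', h'⟩ := hx
  -- Applying `τ` to `d z = g x` gives `σ d · τ z = σ g · τ x`; multiplying by `d'` replaces `d' τ
  -- x` by `g' x`.
  refine ⟨d' * σ d, σ g * g', mul_ne_zero hd' (hσ d hd), ?_⟩
  rw [mul_smul, ← hτ, h, hτ, smul_comm, h', mul_smul]

theorem prodMap_mem_saturatedSpan {N : Type u} [AddCommGroup N] [Module R N] {σ : R → R}
    (hσ : ∀ r, r ≠ 0 → σ r ≠ 0) {τ : M → M} (hτ : ∀ r m, τ (r • m) = σ r • τ m) {τ' : N → N}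
    (hτ' : ∀ r n, τ' (r • n) = σ r • τ' n) {x : M} {y : N}
    (h : (τ x, τ' y) ∈ saturatedSpan (R := R) (x, y)) {u : M} {v : N}
    (hz : (u, v) ∈ saturatedSpan (R := R) (x, y)) :
    (τ u, τ' v) ∈ saturatedSpan (R := R) (x, y) :=
  map_mem_saturatedSpan (τ := Prod.map τ τ') hσ
    (fun r z => Prod.ext (hτ r z.1) (hτ' r z.2)) h hz

/-- The two equations may need different fractions for `f`; cross-multiplication supplies a common
one, so that a single pair of scalars works in both components. -/
theorem mk_mem_saturatedSpan {N : Type u} [AddCommGroup N] [Module R N] {x x' : M} {y y' : N}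
    {f : FractionRing R}
    (h : ((1 : FractionRing R) ⊗ₜ[R] x' : FractionRing R ⊗[R] M) =
      f • ((1 : FractionRing R) ⊗ₜ[R] x))
    (h' : ((1 : FractionRing R) ⊗ₜ[R] y' : FractionRing R ⊗[R] N) =
      f • ((1 : FractionRing R) ⊗ₜ[R] y)) :
    (x', y') ∈ saturatedSpan (R := R) (x, y) := by
  obtain ⟨d, g, hd, hdf, h⟩ := one_tmul_eq_smul_iff.1 h
  obtain ⟨d', g', hd', hdf', h'⟩ := one_tmul_eq_smul_iff.1 h'
  have hgg : d' * g = d * g' := by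
    apply IsFractionRing.injective R (FractionRing R)
    rw [map_mul, map_mul, ← hdf, ← hdf', mul_left_comm]
  refine ⟨d' * d, d' * g, mul_ne_zero hd' hd, Prod.ext ?_ ?_⟩
  · change (d' * d) • x' = (d' * g) • x
    rw [mul_smul, h, mul_smul]
  · change (d' * d) • y' = (d' * g) • y
    rw [mul_comm, mul_smul, h', hgg, mul_smul]

/-- The first component determines the ratio, as `x` is not torsion; the second then yields an
equation whose denominator cancels, as `N` is torsion-free. -/
theorem eq_smul_of_mem_saturatedSpan {N : Type u} [AddCommGroup N] [Module R N] {x : M}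
    (hx : ∀ r : R, r • x = 0 → r = 0) (hN : ∀ (r : R) (n : N), r ≠ 0 → r • n = 0 → n = 0)
    {y v : N} {s : R} (h : (s • x, v) ∈ saturatedSpan (R := R) (x, y)) : v = s • y := by
  obtain ⟨c, r, hc, hcr⟩ := h
  have h1 : c • s • x = r • x := congrArg Prod.fst hcr
  have h2 : c • v = r • y := congrArg Prod.snd hcr
  rw [smul_smul, ← sub_eq_zero, ← sub_smul] at h1
  rw [← sub_eq_zero.1 (hx _ h1), mul_smul, ← sub_eq_zero, ← smul_sub] at h2
  exact sub_eq_zero.1 (hN c _ hc h2)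

end FractionRing

/-! ### The motive of an Anderson module -/

namespace AndersonModule

section Motive

variable {F A L : Type u} [Field F] [CommRing A] [Algebra F A] [Field L] [Algebra F L]
  {ℓ : A →ₐ[F] L} {D : AndersonModule ℓ}

/-- The endomorphism of the motive given by composition with the `q`-Frobenius. -/
def motiveFrob [Fintype F] (m : D.Motive) : D.Motive :=
  (show D.E ⟶ Ga.additive F L from m) ≫ Ga.frob

theorem scalar_comp_frob [Fintype F] (l : L) :
    (Ga.scalar l : Ga.additive F L ⟶ Ga.additive F L) ≫ Ga.frob =
      Ga.frob ≫ (Ga.scalar (l ^ Fintype.card F) : Ga.additive F L ⟶ Ga.additive F L) := by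
  refine Ga.ext_onB fun b => ?_
  simp only [Ga.onB_comp, LinearMap.comp_apply, Ga.onB_scalar, Ga.onB_frob]
  exact smul_pow l b (Fintype.card F)

theorem comp_comp_comp_eq {𝒞 : Type*} [Category 𝒞] {X Y Z : 𝒞} (e : X ⟶ Y) (m : Y ⟶ Z)
    {s t f : Z ⟶ Z} (h : s ≫ f = f ≫ t) : (e ≫ m ≫ s) ≫ f = e ≫ (m ≫ f) ≫ t := by
  simp only [Category.assoc, h]

theorem motiveFrob_add [Fintype F] (m n : D.Motive) :
    motiveFrob (m + n) = motiveFrob m + motiveFrob n :=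
  Preadditive.add_comp _ _ _ _ _ _

theorem motiveFrob_smul [Fintype F] (r : A ⊗[F] L) (m : D.Motive) :
    motiveFrob (r • m) = tensorTwist F A L r • motiveFrob m := by
  induction r using TensorProduct.induction_on with
  | zero =>
    rw [map_zero, zero_smul, zero_smul]
    exact Limits.zero_comp
  | tmul a l =>
    have h : tensorTwist F A L (a ⊗ₜ l) = a ⊗ₜ (l ^ Fintype.card F) := rfl
    rw [h, TensorProduct.Algebra.smul_def, TensorProduct.Algebra.smul_def]
    exact comp_comp_comp_eq (show D.E ⟶ D.E from D.φ a) (show D.E ⟶ Ga.additive F L from m)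
      (scalar_comp_frob l)
  | add x y hx hy => rw [add_smul, motiveFrob_add, hx, hy, map_add, add_smul]

/-- The element `g ∘ κ` of the motive. -/
def endMotive (κ : D.E ≅ Ga.additive F L) (g : Ga.additive F L ⟶ Ga.additive F L) : D.Motive :=
  κ.hom ≫ g

theorem endMotive_id (κ : D.E ≅ Ga.additive F L) : endMotive κ (𝟙 _) = coordMotive κ :=
  Category.comp_id _

theorem endMotive_inv_comp (κ : D.E ≅ Ga.additive F L) (m : D.Motive) :
    endMotive κ (κ.inv ≫ m) = m :=
  κ.hom_inv_id_assoc _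

theorem endMotive_add (κ : D.E ≅ Ga.additive F L) (g h : Ga.additive F L ⟶ Ga.additive F L) :
    endMotive κ (g + h) = endMotive κ g + endMotive κ h :=
  Preadditive.comp_add _ _ _ _ _ _

theorem endMotive_comp_scalar (κ : D.E ≅ Ga.additive F L)
    (g : Ga.additive F L ⟶ Ga.additive F L) (l : L) :
    endMotive κ (g ≫ Ga.scalar l) = ((1 : A) ⊗ₜ[F] l) • endMotive κ g := by
  rw [TensorProduct.Algebra.smul_def, one_smul]
  exact (Category.assoc _ _ _).symm

theorem endMotive_comp_frob [Fintype F] (κ : D.E ≅ Ga.additive F L)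
    (g : Ga.additive F L ⟶ Ga.additive F L) :
    endMotive κ (g ≫ Ga.frob) = motiveFrob (endMotive κ g) :=
  (Category.assoc _ _ _).symm

theorem endMotive_phiCoord (κ : D.E ≅ Ga.additive F L) (a : A) :
    endMotive κ (phiCoord κ a) = (a ⊗ₜ[F] (1 : L)) • coordMotive κ := by
  rw [TensorProduct.Algebra.smul_def, one_smul]
  exact κ.hom_inv_id_assoc _

/-- A coordinate is not a torsion element of the motive. -/
theorem eq_zero_of_smul_coordMotive [Fintype F] [IsDomain (A ⊗[F] L)] (hD : D.IsDrinfeldHayes)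
    (κ : D.E ≅ Ga.additive F L) {r : A ⊗[F] L} (hr : r • coordMotive κ = 0) : r = 0 := by
  by_contra hr0
  -- The saturated span of `0` is the torsion submodule. It is stable under Frobenius because the
  -- twist is injective, so a torsion `κ` would make every `g ∘ κ`, that is, the whole motive,
  -- torsion.
  have hend (g : Ga.additive F L ⟶ Ga.additive F L) :
      endMotive κ g ∈ saturatedSpan (R := A ⊗[F] L) (0 : D.Motive) := by
    induction g using Ga.end_induction with
    | id => exact ⟨r, 0, hr0, by rw [endMotive_id, hr, zero_smul]⟩
    | add g h hg hh => rw [endMotive_add]; exact add_mem hg hh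
    | scalar g l hg => rw [endMotive_comp_scalar]; exact Submodule.smul_mem _ _ hg
    | frob g hg =>
      rw [endMotive_comp_frob]
      refine map_mem_saturatedSpan (σ := tensorTwist F A L)
        (fun r => (map_ne_zero_iff _ (tensorTwist_injective F A L)).2) motiveFrob_smul ?_ hg
      have h0 : motiveFrob (0 : D.Motive) = 0 := Limits.zero_comp
      rw [h0]
      exact zero_mem _
  have h : Module.rank (A ⊗[F] L) D.Motive = 0 := rank_eq_zero_iff.2 fun m => by
    obtain ⟨d, g, hd, h⟩ := hend (κ.inv ≫ m)
    rw [endMotive_inv_comp, smul_zero] at h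
    exact ⟨d, hd, h⟩
  have h1 := hD.finrank_eq_one
  rw [Module.finrank, h, map_zero] at h1
  exact zero_ne_one h1

theorem existsUnique_isShtukaFunction [Fintype F] [IsDomain (A ⊗[F] L)] (hD : D.IsDrinfeldHayes)
    (κ : D.E ≅ Ga.additive F L) : ∃! f, IsShtukaFunction κ f :=
  have := hD.finite
  existsUnique_one_tmul_eq_smul hD.finrank_eq_one.le
    (fun _ => eq_zero_of_smul_coordMotive hD κ) (frobCoordMotive κ)

end Motive

/-! ### Comparison of the eigenvalue condition with the Frobenius equation -/

section Equivalence

variable {F A L : Type u} [Field F] [CommRing A] [Algebra F A] [Field L] [Algebra F L]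
  {ℓ : A →ₐ[F] L} {D : AndersonModule ℓ} {V : Type u} [NormedField V] [Algebra F V] [Algebra L V]
  [IsScalarTower F L V]

/-- The evaluation `m ↦ (m ∘ κ⁻¹)(ω)` of the motive at an element of the general Tate algebra. -/
def evalMotive (κ : D.E ≅ Ga.additive F L) (ω : Tate F A V) (m : D.Motive) : Tate F A V :=
  Tate.map (Ga.onB (κ.inv ≫ m) V) ω

theorem evalMotive_endMotive (κ : D.E ≅ Ga.additive F L) (ω : Tate F A V)
    (g : Ga.additive F L ⟶ Ga.additive F L) :
    evalMotive κ ω (endMotive κ g) = Tate.map (Ga.onB g V) ω := by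
  rw [evalMotive, endMotive, Iso.inv_hom_id_assoc]

theorem map_onB_comp [Fintype F] (g h : Ga.additive F L ⟶ Ga.additive F L) (ω : Tate F A V) :
    Tate.map (Ga.onB (g ≫ h) V) ω = Tate.map (Ga.onB h V) (Tate.map (Ga.onB g V) ω) := by
  rw [Ga.onB_comp, Tate.map_comp (Ga.continuous_onB g) (Ga.continuous_onB h)]

theorem map_onB_add [Fintype F] (g h : Ga.additive F L ⟶ Ga.additive F L) (ω : Tate F A V) :
    Tate.map (Ga.onB (g + h) V) ω = Tate.map (Ga.onB g V) ω + Tate.map (Ga.onB h V) ω := by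
  rw [Ga.onB_add, Tate.add_map (Ga.continuous_onB g) (Ga.continuous_onB h)]

theorem map_onB_scalar (l : L) (ω : Tate F A V) :
    Tate.map (Ga.onB (Ga.scalar l : Ga.additive F L ⟶ Ga.additive F L) V) ω =
      ((1 : A) ⊗ₜ[F] l) • ω := by
  rw [Ga.onB_scalar_eq_mulLeft, Tate.map_mulLeft]
  rfl

theorem map_onB_frob [Fintype F] (ω : Tate F A V) :
    Tate.map (Ga.onB (Ga.frob : Ga.additive F L ⟶ Ga.additive F L) V) ω = Tate.twist ω := by
  rw [Ga.onB_frob]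
  rfl

theorem map_onB_tmul_one_smul [Fintype F] (g : Ga.additive F L ⟶ Ga.additive F L) (a : A)
    (ω : Tate F A V) :
    Tate.map (Ga.onB g V) ((a ⊗ₜ[F] (1 : L)) • ω) =
      (a ⊗ₜ[F] (1 : L)) • Tate.map (Ga.onB g V) ω := by
  rw [Tate.tmul_one_smul, Tate.map_of_mul (Ga.continuous_onB g), Tate.tmul_one_smul]

theorem conj_comp_eq {𝒞 : Type*} [Category 𝒞] {X Y Z : 𝒞} (κ : X ≅ Y) (e : X ⟶ X) (m : X ⟶ Z)
    (s : Z ⟶ Z) : κ.inv ≫ e ≫ m ≫ s = (κ.inv ≫ e ≫ κ.hom) ≫ (κ.inv ≫ m) ≫ s := by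
  simp only [Category.assoc, Iso.hom_inv_id_assoc]

/-- Compatibility with `L` is automatic; `hω` supplies compatibility with `A`, since `φ_a^κ` is
applied to `ω` before `m ∘ κ⁻¹`, and the latter acts `A`-linearly on `𝕋`. -/
theorem evalMotive_smul [Fintype F] (κ : D.E ≅ Ga.additive F L) {ω : Tate F A V}
    (hω : ∀ a, Tate.map (Ga.onB (phiCoord κ a) V) ω = (a ⊗ₜ[F] (1 : L)) • ω)
    (r : A ⊗[F] L) (m : D.Motive) : evalMotive κ ω (r • m) = r • evalMotive κ ω m := by
  have hadd (m n : D.Motive) : evalMotive κ ω (m + n) = evalMotive κ ω m + evalMotive κ ω n := by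
    have h : κ.inv ≫ (show D.E ⟶ Ga.additive F L from m + n) =
        κ.inv ≫ (show D.E ⟶ Ga.additive F L from m) +
          κ.inv ≫ (show D.E ⟶ Ga.additive F L from n) := Preadditive.comp_add _ _ _ _ _ _
    exact (congrArg (fun g => Tate.map (Ga.onB g V) ω) h).trans (map_onB_add _ _ ω)
  induction r using TensorProduct.induction_on with
  | zero =>
    rw [zero_smul, zero_smul]
    exact (AddMonoidHom.mk' (evalMotive κ ω) hadd).map_zero
  | tmul a l =>
    have h : κ.inv ≫ (show D.E ⟶ Ga.additive F L from (a ⊗ₜ[F] l) • m) =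
        phiCoord κ a ≫ (κ.inv ≫ (show D.E ⟶ Ga.additive F L from m)) ≫ Ga.scalar l := by
      rw [TensorProduct.Algebra.smul_def]
      exact conj_comp_eq κ (show D.E ⟶ D.E from D.φ a) (show D.E ⟶ Ga.additive F L from m) _
    refine (congrArg (fun g => Tate.map (Ga.onB g V) ω) h).trans ?_
    rw [map_onB_comp, map_onB_comp, hω, map_onB_tmul_one_smul, map_onB_scalar, smul_smul,
      Algebra.TensorProduct.tmul_mul_tmul, one_mul, mul_one]
    rfl
  | add x y hx hy => rw [add_smul, hadd, hx, hy, add_smul]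

/-- For a shtuka function `f`, the elements on which `φ_a` acts through `a` are the solutions of
`ω^{(1)} = f ω`. -/
theorem forall_map_phiCoord_iff [Fintype F] [IsUltrametricDist V] [IsDomain (A ⊗[F] L)]
    [IsDomain (A ⊗[F] ResidueField F V)] (hD : D.IsDrinfeldHayes)
    (κ : D.E ≅ Ga.additive F L) {f : FractionRing (A ⊗[F] L)} (hf : IsShtukaFunction κ f)
    (ω : Tate F A V) :
    (∀ a, Tate.map (Ga.onB (phiCoord κ a) V) ω = (a ⊗ₜ[F] (1 : L)) • ω) ↔
      ((1 : FractionRing (A ⊗[F] L)) ⊗ₜ[A ⊗[F] L] Tate.twist ω :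
          FractionRing (A ⊗[F] L) ⊗[A ⊗[F] L] Tate F A V) =
        f • ((1 : FractionRing (A ⊗[F] L)) ⊗ₜ[A ⊗[F] L] ω) := by
  have hfrob : frobCoordMotive κ = endMotive κ Ga.frob := rfl
  constructor
  · intro hω
    obtain ⟨d, g, hd, hdf, h⟩ := one_tmul_eq_smul_iff.1 hf
    refine one_tmul_eq_smul_iff.2 ⟨d, g, hd, hdf, ?_⟩
    -- The relation `d · τκ = g · κ` in the motive is transported to `d ω^{(1)} = g ω` by the linear
    -- evaluation.
    have h1 := congrArg (evalMotive κ ω) h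
    rwa [evalMotive_smul κ hω, evalMotive_smul κ hω, ← endMotive_id, hfrob, evalMotive_endMotive,
      evalMotive_endMotive, map_onB_frob, Ga.onB_id, Tate.map_id] at h1
  · intro hω a
    have hstep : (motiveFrob (coordMotive κ), Tate.twist ω) ∈
        saturatedSpan (R := A ⊗[F] L) (coordMotive κ, ω) := mk_mem_saturatedSpan hf hω
    -- Working in the product of the motive and `𝕋` forces both components to satisfy the same
    -- proportionality; the Frobenius step works because both are semilinear for the same twist.
    have hend (e : Ga.additive F L ⟶ Ga.additive F L) :
        (endMotive κ e, Tate.map (Ga.onB e V) ω) ∈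
          saturatedSpan (R := A ⊗[F] L) (coordMotive κ, ω) := by
      induction e using Ga.end_induction with
      | id =>
        rw [endMotive_id, Ga.onB_id, Tate.map_id]
        exact self_mem_saturatedSpan _
      | add e e' he he' =>
        rw [endMotive_add, map_onB_add, ← Prod.mk_add_mk]
        exact add_mem he he'
      | scalar e l he =>
        rw [endMotive_comp_scalar, map_onB_comp, map_onB_scalar, ← Prod.smul_mk]
        exact Submodule.smul_mem _ _ he
      | frob e he =>
        rw [endMotive_comp_frob, map_onB_comp, map_onB_frob]
        exact prodMap_mem_saturatedSpan
          (fun r => (map_ne_zero_iff _ (tensorTwist_injective F A L)).2)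
          motiveFrob_smul Tate.twist_smul hstep he
    have h := hend (phiCoord κ a)
    rw [endMotive_phiCoord] at h
    exact eq_smul_of_mem_saturatedSpan (fun _ => eq_zero_of_smul_coordMotive hD κ)
      (fun _ _ hr => Tate.eq_zero_of_smul_eq_zero hr) h

end Equivalence

end AndersonModule

end DrinfeldHayes

end

theorem proposition3p15 {F : Type u} [Field F] [Fintype F]
    (C : DrinfeldHayes.PointedCurve F) (P : C.Place) (L : IntermediateField C.K P.Cinf)
    (D : DrinfeldHayes.AndersonModule (DrinfeldHayes.PointedCurve.ell L))
    (hD : D.IsDrinfeldHayes) (κ : D.E ≅ DrinfeldHayes.Ga.additive F L) :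
    (∃! f : FractionRing (C.A ⊗[F] L), DrinfeldHayes.AndersonModule.IsShtukaFunction κ f) ∧
      ∀ f : FractionRing (C.A ⊗[F] L), DrinfeldHayes.AndersonModule.IsShtukaFunction κ f →
        {ω : DrinfeldHayes.Tate F C.A P.Cinf |
            ∀ a : C.A,
              DrinfeldHayes.Tate.map
                  (DrinfeldHayes.Ga.onB (DrinfeldHayes.AndersonModule.phiCoord κ a) P.Cinf) ω =
                DrinfeldHayes.Tate.of (a ⊗ₜ[F] 1) * ω} =
          {ω : DrinfeldHayes.Tate F C.A P.Cinf |
            ((1 : FractionRing (C.A ⊗[F] L)) ⊗ₜ[C.A ⊗[F] L] DrinfeldHayes.Tate.twist ω :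
                FractionRing (C.A ⊗[F] L) ⊗[C.A ⊗[F] L] DrinfeldHayes.Tate F C.A P.Cinf) =
              f • ((1 : FractionRing (C.A ⊗[F] L)) ⊗ₜ[C.A ⊗[F] L] ω)} := by
  have hAL : IsDomain (C.A ⊗[F] L) := C.isDomain_tensorProduct L
  -- This second domain is where Gauss norms of products are computed, by reduction.
  have hAk : IsDomain (C.A ⊗[F] DrinfeldHayes.ResidueField F P.Cinf) :=
    C.isDomain_tensorProduct _
  refine ⟨DrinfeldHayes.AndersonModule.existsUnique_isShtukaFunction hD κ, fun f hf => ?_⟩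
  ext ω
  refine Iff.trans (forall_congr' fun a => ?_)
    (DrinfeldHayes.AndersonModule.forall_map_phiCoord_iff hD κ hf ω)
  rw [DrinfeldHayes.Tate.tmul_one_smul]
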